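/- **Setting.** Let $\tau_R\in\mathbb R$, $\tau_L>0$, $\delta_L,\delta_R>0$. Put $A_L=\begin{bmatrix}\tau_L&1\\-\delta_L&0\end{bmatrix}$, $A_R=\begin{bmatrix}\tau_R&1\\-\delta_R&0\end{bmatrix}$, $f_L(Z)=A_LZ+(1,0)^T$, $f_R(Z)=A_RZ+(1,0)^T$, and let $f:\mathbb R^2\to\mathbb R^2$ be the border-collision normal form, $f=f_L$ on $\Pi_L=\{x\le 0\}$ and $f=f_R$ on $\Pi_R=\{x\ge 0\}$; it is injective. Let $\Sigma=\{x=0\}$, $\Phi=\{x<0,\ y\le 0\}$, $\Phi_{\rm pre}=\bigcup_{n\ge1}f^{-n}(\Phi)$. The induced map is $F(Z)=f^n(Z)$ with $n=n(Z)\ge1$ smallest such that $f^n(Z)\in\Phi$ (defined on $\Phi\cap\Phi_{\rm pre}$). Let $\chi_L(Z)$ (resp. $\chi_R(Z)$) be the smallest $i\ge1$ with $f^i(Z)\notin\Pi_L$ (resp. $\notin\Pi_R$). When the line $f_L^{-i}(\Sigma)$ is not vertical write it as $y=m_ix+c_i$; let $p^*$ be the smallest $i\ge1$ with $m_i\ge0$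 ($p^*=\infty$ if there is none). For $1\le p\le p^*$, $p<\infty$, let $P_p=(0,c_p)$, $q_p=\chi_R\big(f_L^{\chi_L(P_p)}(P_p)\big)$, $F_p=f_R^{q_p}\big(f_L^{\chi_L(P_p)}(P_p)\big)$, and let $U_p$ be the point where the line through $F_p$ and $f^{-1}(F_p)$ meets $\Sigma$. Write $\pi_1,\pi_2$ for the coordinates. Say that $p$ satisfies (S) if $f(P_p)\in\Phi_{\rm pre}$, $\pi_2(U_p)>\pi_2(P_p)$ and $\pi_1(f(P_p))\pi_2(F_p)+\pi_2(P_p)\pi_1(F_p)<\pi_1(f(P_p))\pi_2(P_p)$; and that $p$ satisfies (T) if $f(P_p)\in\Phi_{\rm pre}$, $\pi_2(U_p)<\pi_2(P_p)$ and $\pi_1(f(P_p))\pi_2(F_p)+\pi_2(P_p)\pi_1(F_p)>\pi_1(f(P_p))\pi_2(P_p)$. For $p,q\ge 1$ let $M_{p,q}=A_R^qA_L^p$. Let $K=[0,\pi)$ with $0$ and $\pi$ identified; for $\theta_0,\theta_1\in K$ let $[\theta_0,\theta_1]$ be the usual closed interval if $\theta_0\le\theta_1$, and $\{\theta\in K:\theta\le\theta_1\text{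 or }\theta\ge\theta_0\}$ if $\theta_0>\theta_1$. Let $G_{p,q}:K\to K$ send $\theta$ to the angle in $K$ of the line spanned by $M_{p,q}(\cos\theta,\sin\theta)^T$, and let $H_{p,q}(\theta)=\|M_{p,q}(\cos\theta,\sin\theta)^T\|$ (Euclidean norm). If $\det M_{p,q}<\frac14{\rm trace}(M_{p,q})^2$, then $G_{p,q}$ has exactly two fixed points: $\theta^s_{p,q}$, with $G_{p,q}'\in(0,1)$, and $\theta^u_{p,q}$, with $G_{p,q}'>1$. **Algorithm.** 1. Let $p_{\max}$ be the smallest $p\in\{2,\dots,\min[p^*,15]\}$ satisfying (S); if there is none, STOP. 2. Let $p_{\min}$ be the largest $p\in\{1,\dots,p_{\max}-1\}$ satisfying (T); if there is none, STOP. 3. Let $q_{\min}=\min[q_{p_{\max}},q_{p_{\min}}]$, $q_{\max}=\max[q_{p_{\max}},q_{p_{\min}}]+1$ and $\Gamma=\{(p,q):p_{\min}\le p\le p_{\max},\ q_{\min}\le q\le q_{\max}\}$. If $\det M_{p,q}\ge\frac14{\rm trace}(M_{p,q})^2$ for some $(p,q)\in\Gamma$, STOP. 4. If there is no closed interval in $K$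 (of the form above) that contains $\theta^s_{p,q}$ and does not contain $\theta^u_{p,q}$ for every $(p,q)\in\Gamma$, STOP. 5. Let $J$ be the smallest such interval (the intersection of all of them). If for some $(p,q)\in\Gamma$ the equation $H_{p,q}(\theta)=1$ does not have exactly two solutions in $K$, or it has, with $H_{p,q}$ decreasing at $\theta^{\rm dec}_{p,q}$ and increasing at $\theta^{\rm inc}_{p,q}$, but $J\cap[\theta^{\rm dec}_{p,q},\theta^{\rm inc}_{p,q}]\neq\varnothing$, STOP. Otherwise output CHAOS. Let $$\Omega=\Big\{(x,y)\in\Phi:\ \tfrac{c_{p_{\max}}+1}{c_{p_{\max}}}(c_{p_{\max}}-y)\le x\le\tfrac{c_{p_{\min}}+1}{c_{p_{\min}}}(c_{p_{\min}}-y)\Big\},$$ let $\Xi$ be the set of $Z\in\Omega$ such that $f^i(Z)\in\Sigma$ for some $0\le i<n(Z)$ (the switching manifolds of $F$), let $\Xi_\infty=\bigcup_{i\ge0}\{Z\in\Omega: F^i(Z)\in\Xi\}$, and let $C_J=\{\alpha(\cos\theta,\sin\theta):\alpha\in\mathbb R,\ \theta\in J\}$. **Theorem.** Suppose the algorithm outputs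 CHAOS. Then for every $Z\in\Omega\setminus\Xi_\infty$ all iterates $f^n$ are differentiable at $Z$, and for every nonzero $v\in C_J$ $$\liminf_{n\to\infty}\frac1n\ln\big\|{\rm D}f^n(Z)\,v\big\|>0 .$$ -/

import Mathlib

open Filter Topology

noncomputable section

/-- The plane with its Euclidean norm; `Z 0` and `Z 1` are the two coordinates of `Z`. -/
abbrev Plane : Type := EuclideanSpace ℝ (Fin 2)

/-- Parameters of the border-collision normal form (with `μ = 1`). -/
structure BCNF where
  tauL : ℝ
  deltaL : ℝ
  tauR : ℝ
  deltaR : ℝ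
  tauL_pos : 0 < tauL
  deltaL_pos : 0 < deltaL
  deltaR_pos : 0 < deltaR

/-! ### Lines, angles and cones in the plane -/

/-- The switching manifold, i.e. the vertical axis. -/
def switching : Set Plane := {Z | Z 0 = 0}

/-- The closed left half-plane. -/
def halfL : Set Plane := {Z | Z 0 ≤ 0}

/-- The closed right half-plane. -/
def halfR : Set Plane := {Z | 0 ≤ Z 0}

/-- The closed third quadrant without the vertical axis. -/
def Phi : Set Plane := {Z | Z 0 < 0 ∧ Z 1 ≤ 0}

/-- The point at which the (non-vertical) line through `A` and `B` meets the vertical axis. -/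
def lineMeetsSwitching (A B : Plane) : Plane :=
  !₂[0, A 1 - A 0 * ((B 1 - A 1) / (B 0 - A 0))]

/-- The unit vector `(cos θ, sin θ)`. -/
def unitVec (θ : ℝ) : Plane := !₂[Real.cos θ, Real.sin θ]

/-- The angle in `K = [0, π)` of the line spanned by a nonzero vector `w`:
`w` is a real multiple of `unitVec (lineAngle w)`. -/
def lineAngle (w : Plane) : ℝ :=
  toIcoMod Real.pi_pos 0 (Complex.arg ⟨w 0, w 1⟩)

/-- The action of a `2 × 2` matrix on the plane. -/
def act (M : Matrix (Fin 2) (Fin 2) ℝ) (v : Plane) : Plane := Matrix.toEuclideanLin M v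

theorem act_apply (M : Matrix (Fin 2) (Fin 2) ℝ) (v : Plane) (j : Fin 2) :
    act M v j = M j 0 * v 0 + M j 1 * v 1 := by
  fin_cases j <;> simp [act, Matrix.toLpLin_apply]

/-- The angle map of `M`, as a `π`-periodic function of a real variable with values in `[0, π)`. -/
def angleMap (M : Matrix (Fin 2) (Fin 2) ℝ) (θ : ℝ) : ℝ := lineAngle (act M (unitVec θ))

/-- The norm function of `M`. -/
def normFun (M : Matrix (Fin 2) (Fin 2) ℝ) (θ : ℝ) : ℝ := ‖act M (unitVec θ)‖

/-- `d` is the derivative at `θ` of the angle map of `M`, regarded as a self-map of the circle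
obtained from `[0, π)` by gluing `0` and `π`: some local lift of the angle map to
the real line has derivative `d` at `θ`. -/
def HasAngleDeriv (M : Matrix (Fin 2) (Fin 2) ℝ) (d θ : ℝ) : Prop :=
  ∃ g : ℝ → ℝ, (∀ᶠ t in 𝓝 θ, toIcoMod Real.pi_pos 0 (g t) = angleMap M t) ∧ HasDerivAt g d θ

/-- `θ ∈ K` is a fixed point of the angle map at which the derivative belongs to `(0, 1)`. -/
def IsStableAngle (M : Matrix (Fin 2) (Fin 2) ℝ) (θ : ℝ) : Prop :=
  θ ∈ Set.Ico 0 Real.pi ∧ angleMap M θ = θ ∧ ∃ d, 0 < d ∧ d < 1 ∧ HasAngleDeriv M d θ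

/-- `θ ∈ K` is a fixed point of the angle map at which the derivative exceeds `1`. -/
def IsUnstableAngle (M : Matrix (Fin 2) (Fin 2) ℝ) (θ : ℝ) : Prop :=
  θ ∈ Set.Ico 0 Real.pi ∧ angleMap M θ = θ ∧ ∃ d, 1 < d ∧ HasAngleDeriv M d θ

/-- The closed interval from `θ₀` to `θ₁` of the circle `K = [0, π)`; it wraps around
if `θ₁ < θ₀`. -/
def circIcc (θ₀ θ₁ : ℝ) : Set ℝ :=
  {θ | θ ∈ Set.Ico 0 Real.pi ∧
    ((θ₀ ≤ θ₁ ∧ θ₀ ≤ θ ∧ θ ≤ θ₁) ∨ (θ₁ < θ₀ ∧ (θ ≤ θ₁ ∨ θ₀ ≤ θ)))}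

/-- The cone of all real multiples of the vectors `(cos θ, sin θ)` with `θ ∈ J`. -/
def cone (J : Set ℝ) : Set Plane := {v | ∃ α : ℝ, ∃ θ ∈ J, v = α • unitVec θ}

namespace BCNF

variable (P : BCNF)

/-! ### The map -/

def AL : Matrix (Fin 2) (Fin 2) ℝ := !![P.tauL, 1; -P.deltaL, 0]

def AR : Matrix (Fin 2) (Fin 2) ℝ := !![P.tauR, 1; -P.deltaR, 0]

/-- The left affine piece. -/
def fL (Z : Plane) : Plane := act P.AL Z + !₂[1, 0]

/-- The right affine piece. -/
def fR (Z : Plane) : Plane := act P.AR Z + !₂[1, 0]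

/-- The border-collision normal form (the two pieces agree on the switching manifold). -/
def f (Z : Plane) : Plane :=
  open Classical in if Z 0 ≤ 0 then P.fL Z else P.fR Z

/-! ### The induced map -/

/-- All points that map to `Phi` after at least one iteration. -/
def PhiPre : Set Plane := {Z | ∃ n : ℕ, 1 ≤ n ∧ P.f^[n] Z ∈ Phi}

/-- The domain of the induced map. -/
def Phi0 : Set Plane := P.PhiPre ∩ Phi

/-- The first return time to `Phi`. -/
def returnTime (Z : Plane) : ℕ := sInf {n : ℕ | 1 ≤ n ∧ P.f^[n] Z ∈ Phi}

/-- The induced map (meaningful on `Phi0`). -/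
def F (Z : Plane) : Plane := P.f^[P.returnTime Z] Z

/-- The smallest `i ≥ 1` with `f^i(Z)` outside the closed left half-plane (if there is one). -/
def chiL (Z : Plane) : ℕ := sInf {i : ℕ | 1 ≤ i ∧ P.f^[i] Z ∉ halfL}

/-- The smallest `j ≥ 1` with `f^j(Z)` outside the closed right half-plane (if there is one). -/
def chiR (Z : Plane) : ℕ := sInf {j : ℕ | 1 ≤ j ∧ P.f^[j] Z ∉ halfR}

/-! ### Preimages of the switching manifold under the left piece -/

/-- The slope `m_i` of the line `f_L^{-i}(Σ)`, if that line is not vertical. -/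
def slope (i : ℕ) : ℝ := -(P.AL ^ i) 0 0 / (P.AL ^ i) 0 1

/-- The intercept `c_i` of the line `f_L^{-i}(Σ)` with the vertical axis, if that line is not
vertical. -/
def intercept (i : ℕ) : ℝ := -(P.fL^[i] 0) 0 / (P.AL ^ i) 0 1

theorem fL_iterate_apply_zero (i : ℕ) (Z : Plane) :
    (P.fL^[i] Z) 0 = (P.AL ^ i) 0 0 * Z 0 + (P.AL ^ i) 0 1 * Z 1 + (P.fL^[i] 0) 0 := by
  induction i generalizing Z with
  | zero => simp
  | succ k ih =>
    rw [Function.iterate_succ_apply, Function.iterate_succ_apply, ih (P.fL Z), ih (P.fL 0),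
      pow_succ]
    simp [fL, act_apply, AL, Matrix.mul_apply, Fin.sum_univ_two]
    ring

/-- `slope` and `intercept` are indeed the slope and the intercept of `f_L^{-i}(Σ)`. -/
theorem preimage_switching (i : ℕ) (h : (P.AL ^ i) 0 1 ≠ 0) :
    P.fL^[i] ⁻¹' switching = {Z | Z 1 = P.slope i * Z 0 + P.intercept i} := by
  ext Z
  simp only [switching, Set.mem_preimage, Set.mem_ofPred_eq, slope, intercept]
  rw [P.fL_iterate_apply_zero i Z]
  field_simp
  constructor <;> intro h1 <;> linarith

/-- The smallest `i ≥ 1` with `m_i ≥ 0`, and `∞` if there is none. (All the lines up to that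
one are non-vertical.) -/
def pStar : ℕ∞ := sInf {k : ℕ∞ | ∃ i : ℕ, 1 ≤ i ∧ 0 ≤ P.slope i ∧ k = i}

/-! ### The region `Ω` -/

/-- The point `(0, c_p)`: this is `S` for `p = p_max` and `T` for `p = p_min`. -/
def corner (p : ℕ) : Plane := !₂[0, P.intercept p]

/-- The first point of the orbit of `(0, c_p)` outside the closed left half-plane. -/
def cornerExit (p : ℕ) : Plane := P.fL^[P.chiL (P.corner p)] (P.corner p)

/-- The number `q_S` for `p = p_max`, and `q_T` for `p = p_min`. -/
def cornerQ (p : ℕ) : ℕ := P.chiR (P.cornerExit p)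

/-- The point written `F(S)` for `p = p_max`, and `F(T)` for `p = p_min`. As `S` and `T` lie on the
switching manifold and hence outside the domain of `F`, it is given by `f_R^q (f_L^p (·))` with `p`
and `q` the values of `χ_L` and `χ_R`. -/
def cornerF (p : ℕ) : Plane := P.fR^[P.cornerQ p] (P.cornerExit p)

theorem f_injective : Function.Injective P.f := by
  have hL := P.deltaL_pos
  have hR := P.deltaR_pos
  intro Z W h
  have h0 := congrArg (fun V : Plane => V 0) h
  have h1 := congrArg (fun V : Plane => V 1) h
  have key : Z 0 = W 0 ∧ Z 1 = W 1 := by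
    by_cases hz : Z 0 ≤ 0 <;> by_cases hw : W 0 ≤ 0 <;>
      simp [f, hz, hw, fL, fR, act_apply, AL, AR] at h0 h1
    · have e : Z 0 = W 0 := by
        rcases h1 with h1 | h1
        · exact h1
        · exact absurd h1 hL.ne'
      exact ⟨e, by rw [e] at h0; linarith⟩
    · nlinarith
    · nlinarith
    · have e : Z 0 = W 0 := by
        rcases h1 with h1 | h1
        · exact h1
        · exact absurd h1 hR.ne'
      exact ⟨e, by rw [e] at h0; linarith⟩
  ext j
  fin_cases j
  · exact key.1
  · exact key.2

/-- The inverse of `f`. -/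
def fInv : Plane → Plane := Function.invFun P.f

/-- The point written `U` for `p = p_max`, and `V` for `p = p_min`: the line through `F(S)` and
`f⁻¹(F(S))` meets the switching manifold there. -/
def cornerU (p : ℕ) : Plane := lineMeetsSwitching (P.cornerF p) (P.fInv (P.cornerF p))

/-- The conditions on `S = (0, c_p)`: `f(S)` eventually maps to `Phi`, `U` lies above `S`, and
`F(S)` lies to the right of the line through `S` and `f(S)`. -/
def CondS (p : ℕ) : Prop :=
  let S := P.corner p
  P.f S ∈ P.PhiPre ∧
  P.cornerU p 1 > S 1 ∧
  P.f S 0 * P.cornerF p 1 + S 1 * P.cornerF p 0 < P.f S 0 * S 1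

/-- The conditions on `T = (0, c_p)`: `f(T)` eventually maps to `Phi`, `V` lies below `T`, and
`F(T)` lies to the left of the line through `T` and `f(T)`. -/
def CondT (p : ℕ) : Prop :=
  let T := P.corner p
  P.f T ∈ P.PhiPre ∧
  P.cornerU p 1 < T 1 ∧
  P.f T 0 * P.cornerF p 1 + T 1 * P.cornerF p 0 > P.f T 0 * T 1

/-- The quadrilateral `Ω` (intersected with `Phi`) with vertices `S`, `T`, `f(S)`, `f(T)`. -/
def Omega (pmin pmax : ℕ) : Set Plane :=
  {Z | Z ∈ Phi ∧
    (P.intercept pmax + 1) / P.intercept pmax * (P.intercept pmax - Z 1) ≤ Z 0 ∧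
    Z 0 ≤ (P.intercept pmin + 1) / P.intercept pmin * (P.intercept pmin - Z 1)}

/-- The switching manifolds of `F` on `Ω`: points whose orbit meets the switching manifold of `f`
before it returns to `Phi`. -/
def Xi (pmin pmax : ℕ) : Set Plane :=
  {Z | Z ∈ P.Omega pmin pmax ∧ ∃ i : ℕ, i < P.returnTime Z ∧ P.f^[i] Z ∈ switching}

/-- The points of `Ω` that some iterate of `F` maps to a switching manifold of `F`. -/
def XiInf (pmin pmax : ℕ) : Set Plane :=
  {Z | Z ∈ P.Omega pmin pmax ∧ ∃ i : ℕ, P.F^[i] Z ∈ P.Xi pmin pmax}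

/-! ### The matrices `M_{p,q}` and the interval `J` -/

/-- `M_{p,q} = A_R^q A_L^p`. -/
def M (p q : ℕ) : Matrix (Fin 2) (Fin 2) ℝ := P.AR ^ q * P.AL ^ p

def qMin (pmin pmax : ℕ) : ℕ := min (P.cornerQ pmax) (P.cornerQ pmin)

def qMax (pmin pmax : ℕ) : ℕ := max (P.cornerQ pmax) (P.cornerQ pmin) + 1

/-- The set `Γ` of pairs `(p, q)`. -/
def Gam (pmin pmax : ℕ) : Set (ℕ × ℕ) :=
  {x | pmin ≤ x.1 ∧ x.1 ≤ pmax ∧ P.qMin pmin pmax ≤ x.2 ∧ x.2 ≤ P.qMax pmin pmax}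

/-- The closed interval from `θ₀` to `θ₁` contains the stable fixed points of all `G_{p,q}`,
`(p, q) ∈ Γ`, and none of the unstable ones. -/
def Separates (pmin pmax : ℕ) (θ₀ θ₁ : ℝ) : Prop :=
  θ₀ ∈ Set.Ico 0 Real.pi ∧ θ₁ ∈ Set.Ico 0 Real.pi ∧
  ∀ x ∈ P.Gam pmin pmax, ∀ θ : ℝ,
    (IsStableAngle (P.M x.1 x.2) θ → θ ∈ circIcc θ₀ θ₁) ∧
    (IsUnstableAngle (P.M x.1 x.2) θ → θ ∉ circIcc θ₀ θ₁)

/-- The fixed points of the `G_{p,q}`, `(p, q) ∈ Γ`, are unmixed. -/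
def Unmixed (pmin pmax : ℕ) : Prop := ∃ θ₀ θ₁ : ℝ, P.Separates pmin pmax θ₀ θ₁

/-- The smallest closed interval that contains all the stable fixed points and none of the unstable
ones: the intersection of all such intervals. -/
def J (pmin pmax : ℕ) : Set ℝ :=
  {θ | ∀ θ₀ θ₁ : ℝ, P.Separates pmin pmax θ₀ θ₁ → θ ∈ circIcc θ₀ θ₁}

end BCNF

/-- The equation `H(θ) = 1` has exactly two solutions on `K`, and the norm function `H` of `M` is
decreasing at the first one, `dec`, and increasing at the second one, `inc`. -/
def IsDecInc (M : Matrix (Fin 2) (Fin 2) ℝ) (dec inc : ℝ) : Prop :=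
  dec ≠ inc ∧ {θ | θ ∈ Set.Ico 0 Real.pi ∧ normFun M θ = 1} = {dec, inc} ∧
  deriv (normFun M) dec < 0 ∧ 0 < deriv (normFun M) inc

/-- The algorithm outputs CHAOS, with the values `pmin` and `pmax` found in its first two steps.
The fields are its five steps, none of which stops. -/
structure BCNF.OutputsChaos (P : BCNF) (pmin pmax : ℕ) : Prop where
  step1 : IsLeast {p : ℕ | 2 ≤ p ∧ (p : ℕ∞) ≤ min P.pStar 15 ∧ P.CondS p} pmax
  step2 : IsGreatest {p : ℕ | 1 ≤ p ∧ p ≤ pmax - 1 ∧ P.CondT p} pmin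
  step3 : ∀ x ∈ P.Gam pmin pmax, (P.M x.1 x.2).det < 1 / 4 * (P.M x.1 x.2).trace ^ 2
  step4 : P.Unmixed pmin pmax
  step5 : ∀ x ∈ P.Gam pmin pmax, ∃ dec inc : ℝ,
    IsDecInc (P.M x.1 x.2) dec inc ∧ P.J pmin pmax ∩ circIcc dec inc = ∅

end

noncomputable section

/-! ### Affine maps of border-collision type -/

/-! The proof has a geometric half and a linear-algebra half. The geometric half shows that `F` maps
`Ω` into itself and that each return consists of `p` left steps followed by `q` right steps with
`(p, q) ∈ Γ`. The linear half shows that all these products `M p q` preserve one closed cone and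
expand it uniformly.

Geometry. `Ω` is cut from the third quadrant by two lines, each joining an axis point `(0, c)` to
its image `(c + 1, 0)`; `side c` has the sign of the position relative to such a line. The left
piece carries `(0, c_p)` in `p` steps to `(0, endHeight p)`, and hence the line with parameter `c_p`
to the one with parameter `endHeight p`. Monotonicity of `endHeight` shows that `Ω` first enters the
right half-plane between the two image lines (`LucasPos.exists_first_crossing`). That region is
filled by segments from `(0, s)` to its image. On the right, the orbit of `(0, s)` is a polygon
whose edges are the images of that segment. As the map preserves orientation, the polygon always
turns the same way, and orbits with larger `s` run outside those with smaller `s`: they leave no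
later, cross the axis lower, and leave on the outer side of suitable edges. So conditions (S) and
(T), imposed on the two extreme orbits, control every orbit in between (`Exits.side_exit_nonneg`,
`Exits.side_exit_nonpos`, `Barrier.exists_exit`). The result is `OutputsChaos.exists_excursion`.

Linear algebra. An arc of directions is the set where a product of two linear forms has one sign. A
matrix with eigenvalue ratio in `(0, 1)` preserves an arc that contains its dominant direction and
misses the other one (`arcForm_act_nonneg`). Intersecting over all separating arcs gives a closed
invariant cone, so it is not necessary to know that `J` is itself an arc. The equation `H = 1`
factors the quadratic form `H ^ 2 - 1`, whence `H > 1` on `J`; compactness and finiteness of `Γ`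
give one factor `c > 1` per return (`OutputsChaos.exists_expansion`). Return times are bounded, so
this becomes exponential growth per step (`OutputsChaos.exists_growth`). -/

/-- The affine map with trace `τ` and determinant `δ` that both pieces of the normal form are
instances of. -/
def affStep (τ δ : ℝ) (Z : Plane) : Plane := !₂[τ * Z 0 + Z 1 + 1, -δ * Z 0]

@[simp] theorem affStep_zero (τ δ : ℝ) (Z : Plane) : affStep τ δ Z 0 = τ * Z 0 + Z 1 + 1 := by
  simp [affStep]

@[simp] theorem affStep_one (τ δ : ℝ) (Z : Plane) : affStep τ δ Z 1 = -δ * Z 0 := by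
  simp [affStep]

theorem plane_ext {A B : Plane} (h0 : A 0 = B 0) (h1 : A 1 = B 1) : A = B := by
  ext j
  fin_cases j
  · exact h0
  · exact h1

/-- The point `(1 - t) A + t B`. -/
def mix (t : ℝ) (A B : Plane) : Plane := !₂[(1 - t) * A 0 + t * B 0, (1 - t) * A 1 + t * B 1]

@[simp] theorem mix_apply_zero (t : ℝ) (A B : Plane) : mix t A B 0 = (1 - t) * A 0 + t * B 0 := by
  simp [mix]

@[simp] theorem mix_apply_one (t : ℝ) (A B : Plane) : mix t A B 1 = (1 - t) * A 1 + t * B 1 := by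
  simp [mix]

theorem affStep_mix (τ δ t : ℝ) (A B : Plane) :
    affStep τ δ (mix t A B) = mix t (affStep τ δ A) (affStep τ δ B) := by
  apply plane_ext <;> simp <;> ring

theorem affStep_iterate_mix (τ δ t : ℝ) (A B : Plane) (n : ℕ) :
    (affStep τ δ)^[n] (mix t A B) = mix t ((affStep τ δ)^[n] A) ((affStep τ δ)^[n] B) := by
  induction n with
  | zero => rfl
  | succ n ih => simp only [Function.iterate_succ_apply', ih, affStep_mix]

/-- Positive when `Z` lies to the right of the directed line from `A` to `B`. -/
def orient (A B Z : Plane) : ℝ := (B 1 - A 1) * (Z 0 - A 0) - (B 0 - A 0) * (Z 1 - A 1)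

theorem orient_affStep (τ δ : ℝ) (A B Z : Plane) :
    orient (affStep τ δ A) (affStep τ δ B) (affStep τ δ Z) = δ * orient A B Z := by
  simp [orient]; ring

theorem orient_iterate (τ δ : ℝ) (A B Z : Plane) (n : ℕ) :
    orient ((affStep τ δ)^[n] A) ((affStep τ δ)^[n] B) ((affStep τ δ)^[n] Z)
      = δ ^ n * orient A B Z := by
  induction n with
  | zero => simp
  | succ n ih =>
    simp only [Function.iterate_succ_apply', orient_affStep, ih]
    ring

theorem orient_self_left (A B : Plane) : orient A B A = 0 := by simp [orient]

theorem orient_self_right (A B : Plane) : orient A B B = 0 := by simp [orient]; ring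

theorem orient_mix (t : ℝ) (A B Y Z : Plane) :
    orient A B (mix t Y Z) = (1 - t) * orient A B Y + t * orient A B Z := by
  simp [orient]; ring

/-- The affine functional that vanishes on the line through `(0, s)` and `(s + 1, 0)`. -/
def side (s : ℝ) (Z : Plane) : ℝ := s * (s + 1) - s * Z 0 - (s + 1) * Z 1

theorem side_mix (s t : ℝ) (Y Z : Plane) :
    side s (mix t Y Z) = (1 - t) * side s Y + t * side s Z := by
  simp [side]; ring

/-- The orbit of `(0, s)`. -/
def orb (τ δ s : ℝ) (j : ℕ) : Plane := (affStep τ δ)^[j] !₂[0, s]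

theorem orb_succ (τ δ s : ℝ) (j : ℕ) : orb τ δ s (j + 1) = affStep τ δ (orb τ δ s j) := by
  simp only [orb, Function.iterate_succ_apply']

theorem orb_add (τ δ s : ℝ) (i j : ℕ) :
    orb τ δ s (i + j) = (affStep τ δ)^[i] (orb τ δ s j) := by
  simp only [orb, Function.iterate_add_apply]

@[simp] theorem orb_zero_zero (τ δ s : ℝ) : orb τ δ s 0 0 = 0 := by simp [orb]

@[simp] theorem orb_zero_one (τ δ s : ℝ) : orb τ δ s 0 1 = s := by simp [orb]

theorem orb_succ_zero (τ δ s : ℝ) (j : ℕ) :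
    orb τ δ s (j + 1) 0 = τ * orb τ δ s j 0 + orb τ δ s j 1 + 1 := by
  rw [orb_succ, affStep_zero]

theorem orb_succ_one (τ δ s : ℝ) (j : ℕ) : orb τ δ s (j + 1) 1 = -δ * orb τ δ s j 0 := by
  rw [orb_succ, affStep_one]

@[simp] theorem orb_one_zero (τ δ s : ℝ) : orb τ δ s 1 0 = s + 1 := by
  rw [orb_succ_zero]; simp

@[simp] theorem orb_one_one (τ δ s : ℝ) : orb τ δ s 1 1 = 0 := by
  rw [orb_succ_one]; simp

theorem orient_orb_iterate (τ δ s : ℝ) (j : ℕ) (Z : Plane) :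
    orient (orb τ δ s j) (orb τ δ s (j + 1)) ((affStep τ δ)^[j] Z) = δ ^ j * side s Z := by
  rw [orb_add τ δ s j 1, orb, orient_iterate]
  congr 1
  simp [orient, side]
  ring

/-- The Lucas sequence `s_0 = 0`, `s_1 = 1`, `s_{n+2} = τ s_{n+1} - δ s_n`. -/
def lucasSeq (τ δ : ℝ) : ℕ → ℝ
  | 0 => 0
  | 1 => 1
  | n + 2 => τ * lucasSeq τ δ (n + 1) - δ * lucasSeq τ δ n

/-- The partial sums `s_1 + ⋯ + s_n`. -/
def lucasSum (τ δ : ℝ) : ℕ → ℝ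
  | 0 => 0
  | n + 1 => lucasSum τ δ n + lucasSeq τ δ (n + 1)

theorem lucasSum_rec (τ δ : ℝ) (n : ℕ) :
    lucasSum τ δ (n + 2) = τ * lucasSum τ δ (n + 1) - δ * lucasSum τ δ n + 1 := by
  induction n with
  | zero => simp [lucasSum, lucasSeq]; ring
  | succ n ih =>
    have e1 : lucasSum τ δ (n + 1 + 2) = lucasSum τ δ (n + 2) + lucasSeq τ δ (n + 3) := rfl
    have e2 : lucasSum τ δ (n + 1 + 1) = lucasSum τ δ (n + 1) + lucasSeq τ δ (n + 2) := rfl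
    have e3 : lucasSum τ δ (n + 1) = lucasSum τ δ n + lucasSeq τ δ (n + 1) := rfl
    have e4 : lucasSeq τ δ (n + 3) = τ * lucasSeq τ δ (n + 2) - δ * lucasSeq τ δ (n + 1) := rfl
    linear_combination e1 + ih + e4 - τ * e2 + δ * e3

theorem orb_apply_zero (τ δ s : ℝ) (j : ℕ) :
    orb τ δ s j 0 = lucasSeq τ δ j * s + lucasSum τ δ j := by
  induction j using Nat.twoStepInduction with
  | zero => simp [lucasSeq, lucasSum]
  | one => simp [lucasSeq, lucasSum]
  | more n h1 h2 =>
    rw [orb_succ_zero, orb_succ_one, h1, h2, lucasSum_rec, lucasSeq]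
    ring

/-! ### Orbits that leave the right half-plane -/

/-- The orbit of `(0, s)` leaves the right half-plane at step `q + 1`. -/
structure Exits (τ δ s : ℝ) (q : ℕ) : Prop where
  nonneg : 0 ≤ s
  stay : ∀ i ≤ q, 0 ≤ orb τ δ s i 0
  leave : orb τ δ s (q + 1) 0 < 0

variable {τ δ : ℝ}

/-- Orientation of consecutive triples is preserved, so if the first turn were not inward, no later
one would be. The orbit would then move right and down forever and never reach the left half-plane.
-/
theorem turn_pos_of_leave (hδ : 0 < δ) {s : ℝ} (hs : 0 ≤ s) {j : ℕ} (hj : orb τ δ s j 0 < 0) :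
    0 < side s (orb τ δ s 2) := by
  by_contra hcon
  push Not at hcon
  have key : ∀ n, 0 ≤ orb τ δ s n 0 ∧ orb τ δ s n 0 < orb τ δ s (n + 1) 0 ∧
      orb τ δ s (n + 1) 1 ≤ orb τ δ s n 1 := by
    intro n
    induction n with
    | zero => simp; constructor <;> linarith
    | succ n ih =>
      obtain ⟨h0, h1, h2⟩ := ih
      have ho := orient_orb_iterate τ δ s n (orb τ δ s 2)
      rw [← orb_add] at ho
      have hneg : orient (orb τ δ s n) (orb τ δ s (n + 1)) (orb τ δ s (n + 2)) ≤ 0 := by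
        rw [ho]
        exact mul_nonpos_of_nonneg_of_nonpos (by positivity) hcon
      have e1 := orb_succ_one τ δ s n
      have e2 := orb_succ_one τ δ s (n + 1)
      have hy : orb τ δ s (n + 1 + 1) 1 < orb τ δ s (n + 1) 1 := by
        rw [e1, e2]; nlinarith
      refine ⟨by linarith, ?_, hy.le⟩
      have hid : orient (orb τ δ s n) (orb τ δ s (n + 1)) (orb τ δ s (n + 2))
          = (orb τ δ s (n + 1) 1 - orb τ δ s n 1) * (orb τ δ s (n + 1 + 1) 0 - orb τ δ s (n + 1) 0)
          - (orb τ δ s (n + 1) 0 - orb τ δ s n 0) *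
            (orb τ δ s (n + 1 + 1) 1 - orb τ δ s (n + 1) 1) := by
        simp only [orient]; ring
      rw [hid] at hneg
      by_contra hc
      push Not at hc
      nlinarith [mul_nonneg (sub_nonneg.2 h2) (sub_nonneg.2 hc),
        mul_pos (sub_pos.2 h1) (sub_pos.2 hy)]
  exact absurd (key j).1 (not_le.2 hj)

/-- Pulled back by the map, `side s` vanishes at `(0, s)`, so it is a combination of `side s` and
the abscissa. With nonnegative coefficients this makes the inner side forward invariant as long as
the orbit stays on the right. -/
theorem side_affStep (s : ℝ) (Z : Plane) :
    (s + 1) * side s (affStep τ δ Z) = s * side s Z + Z 0 * side s (orb τ δ s 2) := by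
  have e : orb τ δ s 2 = affStep τ δ (orb τ δ s 1) := orb_succ τ δ s 1
  rw [e]
  simp [side]
  ring

theorem side_affStep_nonneg {s : ℝ} (hs : 0 ≤ s) (ht : 0 < side s (orb τ δ s 2)) {Z : Plane}
    (hZ : 0 ≤ side s Z) (hZ0 : 0 ≤ Z 0) : 0 ≤ side s (affStep τ δ Z) := by
  have h := side_affStep (τ := τ) (δ := δ) s Z
  have : 0 ≤ (s + 1) * side s (affStep τ δ Z) := by rw [h]; positivity
  exact nonneg_of_mul_nonneg_right this (by linarith)

theorem side_iterate_nonneg {s : ℝ} (hs : 0 ≤ s) (ht : 0 < side s (orb τ δ s 2)) {Z : Plane}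
    (hZ : 0 ≤ side s Z) (m : ℕ) (hm : ∀ i < m, 0 ≤ (affStep τ δ)^[i] Z 0) :
    0 ≤ side s ((affStep τ δ)^[m] Z) := by
  induction m with
  | zero => exact hZ
  | succ m ih =>
    rw [Function.iterate_succ_apply']
    exact side_affStep_nonneg hs ht (ih fun i hi => hm i (by omega)) (hm m (by omega))

theorem side_orb_zero (s : ℝ) : side s (orb τ δ s 0) = 0 := by
  simp [side]
  ring

namespace Exits

variable {s : ℝ} {q : ℕ}

theorem turn_pos (hδ : 0 < δ) (h : Exits τ δ s q) : 0 < side s (orb τ δ s 2) :=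
  turn_pos_of_leave hδ h.nonneg h.leave

theorem one_le (h : Exits τ δ s q) : 1 ≤ q := by
  by_contra hq
  have : q = 0 := by omega
  have h1 := h.leave
  rw [this] at h1
  have := h.nonneg
  simp at h1
  linarith

/-- The exit point lies on the inner side of every edge line. If the abscissa fell and then failed
to fall again, two such lines would confine the exit point to abscissas at least that of the vertex
between them, which is nonnegative. -/
theorem unimodal (hδ : 0 < δ) (h : Exits τ δ s q) {m : ℕ} (hm : m < q)
    (hdec : orb τ δ s (m + 1) 0 < orb τ δ s m 0) :
    orb τ δ s (m + 2) 0 < orb τ δ s (m + 1) 0 := by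
  by_contra hc
  push Not at hc
  have ht := h.turn_pos hδ
  have hin : ∀ i ≤ q + 1, 0 ≤ side s (orb τ δ s i) := by
    intro i hi
    have := side_iterate_nonneg (τ := τ) (δ := δ) h.nonneg ht (Z := orb τ δ s 0)
      (side_orb_zero s).ge i
      (fun k hk => by rw [← orb_add]; exact h.stay _ (by omega))
    rwa [← orb_add] at this
  have hor : ∀ k ≤ q + 1, 0 ≤ orient (orb τ δ s k) (orb τ δ s (k + 1)) (orb τ δ s (q + 1)) := by
    intro k hk
    have := orient_orb_iterate τ δ s k (orb τ δ s (q + 1 - k))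
    rw [← orb_add, show k + (q + 1 - k) = q + 1 by omega] at this
    rw [this]
    exact mul_nonneg (by positivity) (hin _ (by omega))
  have h1 := hor m (by omega)
  have h2 := hor (m + 1) (by omega)
  have h3 : 0 < orient (orb τ δ s m) (orb τ δ s (m + 1)) (orb τ δ s (m + 2)) := by
    rw [orb_add τ δ s m 2, orient_orb_iterate]
    positivity
  -- The linear relation between the two edge functionals at their common vertex, solved for the
  -- horizontal displacement.
  have hid : (orb τ δ s (q + 1) 0 - orb τ δ s (m + 1) 0) *
      orient (orb τ δ s m) (orb τ δ s (m + 1)) (orb τ δ s (m + 2))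
      = (orb τ δ s (m + 2) 0 - orb τ δ s (m + 1) 0) *
        orient (orb τ δ s m) (orb τ δ s (m + 1)) (orb τ δ s (q + 1))
      + (orb τ δ s m 0 - orb τ δ s (m + 1) 0) *
        orient (orb τ δ s (m + 1)) (orb τ δ s (m + 1 + 1)) (orb τ δ s (q + 1)) := by
    simp only [orient]; ring
  have h4 : 0 ≤ (orb τ δ s (q + 1) 0 - orb τ δ s (m + 1) 0) *
      orient (orb τ δ s m) (orb τ δ s (m + 1)) (orb τ δ s (m + 2)) := by
    rw [hid]
    exact add_nonneg (mul_nonneg (by linarith) h1) (mul_nonneg (by linarith) h2)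
  have h5 := nonneg_of_mul_nonneg_left h4 h3
  have := h.stay (m + 1) (by omega)
  linarith [h.leave]

theorem decreasing_after (hδ : 0 < δ) (h : Exits τ δ s q) {m n : ℕ} (hmn : m ≤ n) (hn : n ≤ q)
    (hdec : orb τ δ s (m + 1) 0 < orb τ δ s m 0) : orb τ δ s (n + 1) 0 < orb τ δ s n 0 := by
  induction n, hmn using Nat.le_induction with
  | base => exact hdec
  | succ n _ ih => exact h.unimodal hδ (by omega) (ih (by omega))

/-- If `s_n ≤ 0 < s_{n+1}`, the abscissa grows at step `n`, hence by unimodality it never fell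
before. For `s > 0` these inequalities propagate nonpositivity down to `s_1 = 1`; for `s = 0` they
force `s_n = 0`, against the recursion. -/
theorem lucasSeq_pos_of_succ (hδ : 0 < δ) (h : Exits τ δ s q) {n : ℕ} (hn1 : 1 ≤ n) (hn : n ≤ q)
    (hp : 0 < lucasSeq τ δ (n + 1)) : 0 < lucasSeq τ δ n := by
  by_contra hc
  push Not at hc
  have hs := h.nonneg
  have hdiff : ∀ j, orb τ δ s (j + 1) 0 - orb τ δ s j 0
      = (s + 1) * lucasSeq τ δ (j + 1) - s * lucasSeq τ δ j := by
    intro j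
    rw [orb_apply_zero, orb_apply_zero, lucasSum]
    ring
  have hinc : ∀ j ≤ n, 0 ≤ (s + 1) * lucasSeq τ δ (j + 1) - s * lucasSeq τ δ j := by
    intro j hj
    by_contra hneg
    push Not at hneg
    have := h.decreasing_after hδ hj hn (by linarith [hdiff j])
    have h2 := hdiff n
    nlinarith [mul_pos (show 0 < s + 1 by linarith) hp, mul_nonneg hs (neg_nonneg.2 hc)]
  rcases hs.eq_or_lt with h0 | hpos
  · subst h0
    simp only [zero_add, one_mul, zero_mul, sub_zero] at hinc
    obtain ⟨k, rfl⟩ : ∃ k, n = k + 1 := ⟨n - 1, by omega⟩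
    have hz : lucasSeq τ δ (k + 1) = 0 := le_antisymm hc (hinc k (by omega))
    rw [lucasSeq, hz] at hp
    rcases k with _ | k
    · simp [lucasSeq] at hp
    · have := hinc k (by omega)
      nlinarith
  · have hdown : ∀ k, k + 1 ≤ n → lucasSeq τ δ (n - k) ≤ 0 := by
      intro k
      induction k with
      | zero => intro _; simpa using hc
      | succ k ih =>
        intro hk
        have h1 := ih (by omega)
        have h2 := hinc (n - (k + 1)) (by omega)
        rw [show n - (k + 1) + 1 = n - k by omega] at h2
        by_contra hcon
        push Not at hcon
        nlinarith [mul_pos hpos hcon]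
    have := hdown (n - 1) (by omega)
    rw [show n - (n - 1) = 1 by omega] at this
    simp [lucasSeq] at this
    linarith

/-- This term is the coefficient of the starting height in the abscissa of the exit point, so its
sign says that raising the start moves that abscissa further left. Were it positive, all earlier
terms would be too, and the abscissa would be nonnegative. -/
theorem lucasSeq_succ_nonpos (hδ : 0 < δ) (h : Exits τ δ s q) : lucasSeq τ δ (q + 1) ≤ 0 := by
  by_contra hc
  push Not at hc
  have hpos : ∀ k ≤ q, 0 < lucasSeq τ δ (q + 1 - k) := by
    intro k
    induction k with
    | zero => intro _; exact hc
    | succ k ih =>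
      intro hk
      have := ih (by omega)
      rw [show q + 1 - k = (q + 1 - (k + 1)) + 1 by omega] at this
      exact h.lucasSeq_pos_of_succ hδ (by omega) (by omega) this
  have hpos' : ∀ j, 1 ≤ j → j ≤ q + 1 → 0 < lucasSeq τ δ j := by
    intro j h1 h2
    have := hpos (q + 1 - j) (by omega)
    rwa [show q + 1 - (q + 1 - j) = j by omega] at this
  have hsum : ∀ j ≤ q + 1, 0 ≤ lucasSum τ δ j := by
    intro j
    induction j with
    | zero => intro _; simp [lucasSum]
    | succ j ih =>
      intro hj
      rw [lucasSum]
      have := ih (by omega)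
      have := hpos' (j + 1) (by omega) hj
      linarith
  have h1 := h.leave
  rw [orb_apply_zero] at h1
  have := hsum (q + 1) le_rfl
  have := mul_nonneg hc.le h.nonneg
  linarith

/-- The orbit of a higher point leaves the half-plane, and does so no later. -/
theorem exists_of_le (hδ : 0 < δ) (h : Exits τ δ s q) {s' : ℝ} (hs : s ≤ s') :
    ∃ q' ≤ q, Exits τ δ s' q' := by
  classical
  have hl : orb τ δ s' (q + 1) 0 < 0 := by
    have h1 := h.leave
    rw [orb_apply_zero] at h1 ⊢
    nlinarith [h.lucasSeq_succ_nonpos hδ]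
  have hex : ∃ j, orb τ δ s' (j + 1) 0 < 0 := ⟨q, hl⟩
  refine ⟨Nat.find hex, Nat.find_min' hex hl, h.nonneg.trans hs, ?_, Nat.find_spec hex⟩
  intro i hi
  rcases i with _ | i
  · simp
  · exact not_lt.1 (Nat.find_min hex (show i < Nat.find hex by omega))

theorem unique (h : Exits τ δ s q) {q' : ℕ} (h' : Exits τ δ s q') : q = q' := by
  rcases lt_trichotomy q q' with hlt | heq | hlt
  · exact absurd (h'.stay (q + 1) (by omega)) (not_le.2 h.leave)
  · exact heq
  · exact absurd (h.stay (q' + 1) (by omega)) (not_le.2 h'.leave)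

theorem le_of_le (hδ : 0 < δ) (h : Exits τ δ s q) {s' : ℝ} {q' : ℕ} (h' : Exits τ δ s' q')
    (hs : s ≤ s') : q' ≤ q := by
  obtain ⟨k, hk, hk'⟩ := h.exists_of_le hδ hs
  rwa [h'.unique hk']

end Exits
end

/-! ### The exit edge and its crossing with the vertical axis. -/

noncomputable section

variable {τ δ : ℝ}

/-- The value at the origin of the functional `orient` of the `n`-th edge of the orbit. -/
def pivot (τ δ s : ℝ) (n : ℕ) : ℝ :=
  orb τ δ s (n + 1) 0 * orb τ δ s n 1 - orb τ δ s (n + 1) 1 * orb τ δ s n 0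

/-- The point `(0, -1)` maps to the origin, so the next edge functional at the origin is `δ` times
the present one at `(0, -1)`. -/
theorem pivot_succ (s : ℝ) (n : ℕ) :
    pivot τ δ s (n + 1)
      = δ * (pivot τ δ s n + (orb τ δ s (n + 1) 0 - orb τ δ s n 0)) := by
  simp only [pivot, orb_succ_zero, orb_succ_one]
  ring

theorem orient_orb_eq (s : ℝ) (n : ℕ) (Z : Plane) :
    orient (orb τ δ s n) (orb τ δ s (n + 1)) Z
      = (orb τ δ s (n + 1) 1 - orb τ δ s n 1) * Z 0
        - (orb τ δ s (n + 1) 0 - orb τ δ s n 0) * Z 1 + pivot τ δ s n := by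
  simp only [orient, pivot]
  ring

/-- The height at which the edge of the orbit that leaves the right half-plane
meets the vertical axis. -/
def crossing (τ δ s : ℝ) (q : ℕ) : ℝ :=
  -pivot τ δ s q / (orb τ δ s q 0 - orb τ δ s (q + 1) 0)

/-- The ray through `F` splits the third quadrant into two cones, one spanned with the vertical
half-axis and one with the horizontal; `G` lies in one of them. -/
theorem conic_decomposition {v w fx fy gx gy : ℝ} (hv : v < 0) (hw : w < 0) (hfx : fx < 0)
    (hfy : fy ≤ 0) (hgx : gx < 0) (hgy : gy ≤ 0) :
    (∃ a b : ℝ, 0 ≤ a ∧ 0 ≤ b ∧ gx = b * fx ∧ gy = a * v + b * fy) ∨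
    (∃ b c : ℝ, 0 ≤ b ∧ 0 ≤ c ∧ gx = b * fx + c * w ∧ gy = b * fy) := by
  have hv' := hv.ne
  have hw' := hw.ne
  have hfx' := hfx.ne
  by_cases h : gy - gx / fx * fy ≤ 0
  · left
    refine ⟨(gy - gx / fx * fy) / v, gx / fx, div_nonneg_of_nonpos h hv.le,
      div_nonneg_of_nonpos hgx.le hfx.le, ?_, ?_⟩
    · field_simp
    · field_simp; ring
  · right
    push Not at h
    have hb : 0 < gx / fx := div_pos_of_neg_of_neg hgx hfx
    have hfy' : fy < 0 := by
      rcases hfy.eq_or_lt with h0 | h0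
      · rw [h0] at h; linarith
      · exact h0
    have hfy0 := hfy'.ne
    have hlt : gy / fy ≤ gx / fx := by
      rw [div_le_iff_of_neg hfy']; linarith
    refine ⟨gy / fy, (gx - gy / fy * fx) / w, div_nonneg_of_nonpos hgy hfy,
      div_nonneg_of_nonpos ?_ hw.le, ?_, ?_⟩
    · have e : gx = gx / fx * fx := by field_simp
      nlinarith
    · field_simp; ring
    · field_simp

/-- If `G` lies in the third quadrant, on the inner side of the lines `V F` and `F E`
with `V = (0, v)` and `E = (w, 0)`, then an affine functional that is nonnegative at `V`, `F`,
`E` and at the origin is nonnegative at `G`. -/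
theorem functional_nonneg_of_inside {v w fx fy gx gy : ℝ} (hv : v < 0) (hw : w < 0) (hfx : fx < 0)
    (hfy : fy ≤ 0) (hgx : gx < 0) (hgy : gy ≤ 0) {k k' : ℝ × ℝ × ℝ} {l0 l1 l2 : ℝ}
    (hk0 : 0 < k.2.2) (hkV : k.2.1 * v + k.2.2 = 0) (hkF : k.1 * fx + k.2.1 * fy + k.2.2 = 0)
    (hkG : 0 ≤ k.1 * gx + k.2.1 * gy + k.2.2)
    (hk0' : 0 < k'.2.2) (hkE : k'.1 * w + k'.2.2 = 0)
    (hkF' : k'.1 * fx + k'.2.1 * fy + k'.2.2 = 0)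
    (hkG' : 0 ≤ k'.1 * gx + k'.2.1 * gy + k'.2.2)
    (hlO : 0 ≤ l2) (hlV : 0 ≤ l1 * v + l2) (hlF : 0 ≤ l0 * fx + l1 * fy + l2)
    (hlE : 0 ≤ l0 * w + l2) : 0 ≤ l0 * gx + l1 * gy + l2 := by
  rcases conic_decomposition hv hw hfx hfy hgx hgy with ⟨a, b, ha, hb, e0, e1⟩ | ⟨b, c, hb, hc, e0, e1⟩
  -- A functional that vanishes at `V` and `F` takes at `G` the value `1 - a - b` times its value at
  -- the origin, so `a + b ≤ 1` and `G` is a convex combination of `V`, `F` and the origin.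
  · have e : k.1 * gx + k.2.1 * gy + k.2.2 = (1 - a - b) * k.2.2 := by
      rw [e0, e1]; linear_combination a * hkV + b * hkF
    rw [e] at hkG
    have hab := nonneg_of_mul_nonneg_left hkG hk0
    have : l0 * gx + l1 * gy + l2 = a * (l1 * v + l2) + b * (l0 * fx + l1 * fy + l2)
        + (1 - a - b) * l2 := by rw [e0, e1]; ring
    rw [this]
    positivity
  · have e : k'.1 * gx + k'.2.1 * gy + k'.2.2 = (1 - b - c) * k'.2.2 := by
      rw [e0, e1]; linear_combination c * hkE + b * hkF'
    rw [e] at hkG'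
    have hab := nonneg_of_mul_nonneg_left hkG' hk0'
    have : l0 * gx + l1 * gy + l2 = b * (l0 * fx + l1 * fy + l2) + c * (l0 * w + l2)
        + (1 - b - c) * l2 := by rw [e0, e1]; ring
    rw [this]
    positivity

/-- If `G` lies in the third quadrant, on the outer side of a line that has `V = (0, v)`, `F` and
`E = (w, 0)` on its inner side, then an affine functional that is nonpositive at `V`, `F`, `E`
and nonnegative at the origin is nonpositive at `G`. -/
theorem functional_nonpos_of_outside {v w fx fy gx gy : ℝ} (hv : v < 0) (hw : w < 0) (hfx : fx < 0)
    (hfy : fy ≤ 0) (hgx : gx < 0) (hgy : gy ≤ 0) {k0 k1 k2 l0 l1 l2 : ℝ}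
    (hkO : 0 < k2) (hkV : 0 ≤ k1 * v + k2) (hkF : 0 ≤ k0 * fx + k1 * fy + k2)
    (hkE : 0 ≤ k0 * w + k2) (hkG : k0 * gx + k1 * gy + k2 ≤ 0)
    (hlO : 0 ≤ l2) (hlV : l1 * v + l2 ≤ 0) (hlF : l0 * fx + l1 * fy + l2 ≤ 0)
    (hlE : l0 * w + l2 ≤ 0) : l0 * gx + l1 * gy + l2 ≤ 0 := by
  rcases conic_decomposition hv hw hfx hfy hgx hgy with ⟨a, b, ha, hb, e0, e1⟩ | ⟨b, c, hb, hc, e0, e1⟩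
  · have e : k0 * gx + k1 * gy + k2 = a * (k1 * v + k2) + b * (k0 * fx + k1 * fy + k2)
        + (1 - a - b) * k2 := by rw [e0, e1]; ring
    have hab : 1 - a - b ≤ 0 := by
      by_contra hc
      push Not at hc
      have := mul_pos hc hkO
      have := mul_nonneg ha hkV
      have := mul_nonneg hb hkF
      linarith
    have : l0 * gx + l1 * gy + l2 = a * (l1 * v + l2) + b * (l0 * fx + l1 * fy + l2)
        + (1 - a - b) * l2 := by rw [e0, e1]; ring
    have := mul_nonpos_of_nonneg_of_nonpos ha hlV
    have := mul_nonpos_of_nonneg_of_nonpos hb hlF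
    have := mul_nonpos_of_nonpos_of_nonneg hab hlO
    linarith
  · have e : k0 * gx + k1 * gy + k2 = b * (k0 * fx + k1 * fy + k2) + c * (k0 * w + k2)
        + (1 - b - c) * k2 := by rw [e0, e1]; ring
    have hab : 1 - b - c ≤ 0 := by
      by_contra hcon
      push Not at hcon
      have := mul_pos hcon hkO
      have := mul_nonneg hc hkE
      have := mul_nonneg hb hkF
      linarith
    have : l0 * gx + l1 * gy + l2 = b * (l0 * fx + l1 * fy + l2) + c * (l0 * w + l2)
        + (1 - b - c) * l2 := by rw [e0, e1]; ring
    have := mul_nonpos_of_nonneg_of_nonpos hc hlE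
    have := mul_nonpos_of_nonneg_of_nonpos hb hlF
    have := mul_nonpos_of_nonpos_of_nonneg hab hlO
    linarith

namespace Exits

variable {s : ℝ} {q : ℕ}

theorem last_lt (h : Exits τ δ s q) : orb τ δ s (q + 1) 0 < orb τ δ s q 0 := by
  linarith [h.stay q le_rfl, h.leave]

theorem exit_one_nonpos (hδ : 0 < δ) (h : Exits τ δ s q) : orb τ δ s (q + 1) 1 ≤ 0 := by
  rw [orb_succ_one]
  nlinarith [h.stay q le_rfl]

theorem pivot_last_pos (hδ : 0 < δ) (h : Exits τ δ s q) : 0 < pivot τ δ s q := by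
  obtain ⟨k, rfl⟩ : ∃ k, q = k + 1 := ⟨q - 1, by have := h.one_le; omega⟩
  have h1 := h.leave
  have h2 := h.stay (k + 1) le_rfl
  have h3 := h.stay k (by omega)
  have h4 := orb_succ_zero τ δ s (k + 1)
  have h5 := orb_succ_one τ δ s (k + 1)
  have h6 := orb_succ_one τ δ s k
  simp only [pivot]
  rw [h5]
  have hy : orb τ δ s (k + 1) 1 ≤ 0 := by rw [h6]; nlinarith
  rcases h2.eq_or_lt with h0 | hpos
  · rw [← h0] at h4 ⊢
    nlinarith
  · nlinarith [mul_nonneg_of_nonpos_of_nonpos h1.le hy, mul_pos hδ (mul_pos hpos hpos)]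

/-- While the abscissa does not decrease, positivity passes forward from the start through
`pivot_succ`; once it decreases, positivity passes backward from the exit edge. By unimodality one
of the two always applies. -/
theorem pivot_pos (hδ : 0 < δ) (h : Exits τ δ s q) {n : ℕ} (hn1 : 1 ≤ n) (hn : n ≤ q) :
    0 < pivot τ δ s n := by
  by_cases hdec : ∃ m < n, orb τ δ s (m + 1) 0 < orb τ δ s m 0
  · obtain ⟨m, hm, hd⟩ := hdec
    have key : ∀ k, k + n ≤ q → 0 < pivot τ δ s (q - k) := by
      intro k
      induction k with
      | zero => intro _; exact h.pivot_last_pos hδ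
      | succ k ih =>
        intro hk
        have h1 := ih (by omega)
        have h2 := h.decreasing_after hδ (show m ≤ q - (k + 1) by omega) (by omega) hd
        rw [show q - k = (q - (k + 1)) + 1 by omega, pivot_succ] at h1
        have := pos_of_mul_pos_right h1 hδ.le
        linarith
    have := key (q - n) (by omega)
    rwa [show q - (q - n) = n by omega] at this
  · push Not at hdec
    induction n, hn1 using Nat.le_induction with
    | base =>
      have hs := h.nonneg
      rw [pivot_succ]
      have : 0 ≤ pivot τ δ s 0 := by simp [pivot]; positivity
      simp
      positivity
    | succ k hk ih =>
      rw [pivot_succ]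
      have h1 := ih (by omega) fun m hm => hdec m (by omega)
      have h2 := hdec k (by omega)
      exact mul_pos hδ (by linarith)

theorem crossing_neg (hδ : 0 < δ) (h : Exits τ δ s q) : crossing τ δ s q < 0 := by
  rw [crossing, neg_div]
  have := h.last_lt
  have := div_pos (h.pivot_last_pos hδ) (show 0 < orb τ δ s q 0 - orb τ δ s (q + 1) 0 by linarith)
  linarith

theorem crossing_mul (h : Exits τ δ s q) :
    crossing τ δ s q * (orb τ δ s q 0 - orb τ δ s (q + 1) 0) = -pivot τ δ s q := by
  rw [crossing, div_mul_cancel₀]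
  linarith [h.last_lt]

/-- The edge after the exit edge has the origin on its inner side exactly when the crossing lies
below `-1`, that is, when the image of the crossing point lies on the negative horizontal axis. -/
theorem pivot_succ_eq (h : Exits τ δ s q) :
    pivot τ δ s (q + 1)
      = -δ * ((crossing τ δ s q + 1) * (orb τ δ s q 0 - orb τ δ s (q + 1) 0)) := by
  rw [pivot_succ]
  linear_combination δ * h.crossing_mul

theorem crossing_eq_mix (h : Exits τ δ s q) :
    ∃ t : ℝ, 0 ≤ t ∧ t ≤ 1 ∧
      !₂[0, crossing τ δ s q] = mix t (orb τ δ s q) (orb τ δ s (q + 1)) := by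
  have h1 := h.last_lt
  have h2 := h.stay q le_rfl
  have h3 := h.leave
  have hd : 0 < orb τ δ s q 0 - orb τ δ s (q + 1) 0 := by linarith
  refine ⟨orb τ δ s q 0 / (orb τ δ s q 0 - orb τ δ s (q + 1) 0), by positivity, ?_, ?_⟩
  · rw [div_le_one hd]; linarith
  · apply plane_ext
    · simp
      field_simp
      ring
    · simp [crossing, pivot]
      field_simp
      ring

theorem crossing_eq_iterate (h : Exits τ δ s q) :
    ∃ t : ℝ, 0 ≤ t ∧ t ≤ 1 ∧
      !₂[0, crossing τ δ s q] = (affStep τ δ)^[q] (mix t (orb τ δ s 0) (orb τ δ s 1)) := by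
  obtain ⟨t, h0, h1, e⟩ := h.crossing_eq_mix
  refine ⟨t, h0, h1, ?_⟩
  rw [e, affStep_iterate_mix, ← orb_add, ← orb_add, add_zero]

theorem orient_crossing (h : Exits τ δ s q) (w : ℝ) :
    orient (orb τ δ s q) (orb τ δ s (q + 1)) !₂[0, w]
      = (orb τ δ s q 0 - orb τ δ s (q + 1) 0) * (w - crossing τ δ s q) := by
  rw [orient_orb_eq]
  simp
  linear_combination h.crossing_mul

theorem mix_stay (h : Exits τ δ s q) {t : ℝ} (ht0 : 0 ≤ t) (ht1 : t ≤ 1) {i : ℕ} (hi : i < q) :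
    0 ≤ (affStep τ δ)^[i] (mix t (orb τ δ s 0) (orb τ δ s 1)) 0 := by
  rw [affStep_iterate_mix, ← orb_add, ← orb_add, mix_apply_zero, add_zero]
  have h1 := h.stay i (by omega)
  have h2 := h.stay (i + 1) (by omega)
  have : 0 ≤ 1 - t := by linarith
  positivity

theorem side_mix_nonneg {s₁ s₂ t : ℝ} (hs1 : 0 ≤ s₁) (hs : s₁ ≤ s₂) (ht0 : 0 ≤ t) (ht1 : t ≤ 1) :
    0 ≤ side s₂ (mix t (orb τ δ s₁ 0) (orb τ δ s₁ 1)) := by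
  rw [side_mix]
  have : 0 ≤ 1 - t := by linarith
  have h1 : 0 ≤ side s₂ (orb τ δ s₁ 0) := by simp [side]; nlinarith
  have h2 : 0 ≤ side s₂ (orb τ δ s₁ 1) := by simp [side]; nlinarith
  positivity

/-! ### Comparison of the exits of two orbits. -/

section comparison

variable {s₁ s₂ : ℝ} {q₁ q₂ : ℕ}

theorem side_orb_nonneg (hδ : 0 < δ) (h₁ : Exits τ δ s₁ q₁) (h₂ : Exits τ δ s₂ q₂) (hs : s₁ ≤ s₂)
    {k : ℕ} (hk : k ≤ q₁ + 1) : 0 ≤ side s₂ (orb τ δ s₁ k) := by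
  have h0 : 0 ≤ side s₂ (orb τ δ s₁ 0) := by
    simp [side]; nlinarith [h₁.nonneg]
  have := side_iterate_nonneg (τ := τ) (δ := δ) h₂.nonneg (h₂.turn_pos hδ) h0 k
    (fun i hi => by rw [← orb_add]; exact h₁.stay _ (by omega))
  rwa [← orb_add, add_zero] at this

/-- The inner crossing point is an iterate of a point of the initial inner segment. After `q₁ - q₂`
steps that point is still inside the outer line, and the remaining `q₂` steps carry this line to the
outer exit edge. -/
theorem crossing_le (hδ : 0 < δ) (h₁ : Exits τ δ s₁ q₁) (h₂ : Exits τ δ s₂ q₂) (hs : s₁ ≤ s₂) :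
    crossing τ δ s₂ q₂ ≤ crossing τ δ s₁ q₁ := by
  obtain ⟨t, ht0, ht1, e⟩ := h₁.crossing_eq_iterate
  have hq := h₁.le_of_le hδ h₂ hs
  have hin := side_iterate_nonneg (τ := τ) (δ := δ) h₂.nonneg (h₂.turn_pos hδ)
    (side_mix_nonneg (τ := τ) (δ := δ) h₁.nonneg hs ht0 ht1) (q₁ - q₂)
    (fun i hi => h₁.mix_stay ht0 ht1 (by omega))
  have ho := h₂.orient_crossing (crossing τ δ s₁ q₁)
  rw [e, show q₁ = q₂ + (q₁ - q₂) by omega, Function.iterate_add_apply, orient_orb_iterate,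
    ← show q₁ = q₂ + (q₁ - q₂) by omega] at ho
  have hpos : 0 ≤ (orb τ δ s₂ q₂ 0 - orb τ δ s₂ (q₂ + 1) 0) *
      (crossing τ δ s₁ q₁ - crossing τ δ s₂ q₂) := by
    rw [← ho]; positivity
  have := nonneg_of_mul_nonneg_right hpos (by linarith [h₂.last_lt])
  linarith

theorem orient_exit_nonneg (hδ : 0 < δ) (h₁ : Exits τ δ s₁ q₁) (h₂ : Exits τ δ s₂ q₂)
    (hs : s₁ ≤ s₂) {k : ℕ} (hk : k ≤ q₂ + 1) :
    0 ≤ orient (orb τ δ s₂ k) (orb τ δ s₂ (k + 1)) (orb τ δ s₁ (q₁ + 1)) := by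
  have hq := h₁.le_of_le hδ h₂ hs
  rw [show q₁ + 1 = k + (q₁ + 1 - k) by omega, orb_add τ δ s₁, orient_orb_iterate]
  have := side_orb_nonneg hδ h₁ h₂ hs (k := q₁ + 1 - k) (by omega)
  positivity

/-- The first exit point of an inner orbit is on the inner side of a line that has the first exit
of an outer orbit on its inner side. -/
theorem side_exit_nonneg (hδ : 0 < δ) (h₁ : Exits τ δ s₁ q₁) (h₂ : Exits τ δ s₂ q₂)
    (hs : s₁ ≤ s₂) {c : ℝ} (hc : c ≤ -1) (hu : c ≤ crossing τ δ s₂ q₂)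
    (hu1 : crossing τ δ s₂ q₂ < -1) (hF : 0 ≤ side c (orb τ δ s₂ (q₂ + 1))) :
    0 ≤ side c (orb τ δ s₁ (q₁ + 1)) := by
  have k1 := h₁.orient_exit_nonneg hδ h₂ hs (k := q₂) (by omega)
  have k2 := h₁.orient_exit_nonneg hδ h₂ hs (k := q₂ + 1) (by omega)
  have f1 := orient_self_right (orb τ δ s₂ q₂) (orb τ δ s₂ (q₂ + 1))
  have f2 := orient_self_left (orb τ δ s₂ (q₂ + 1)) (orb τ δ s₂ (q₂ + 2))
  have v1 := h₂.crossing_mul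
  have p1 := h₂.pivot_last_pos hδ
  have p2 := h₂.pivot_succ_eq
  have p3 : 0 < pivot τ δ s₂ (q₂ + 1) := by
    rw [p2]
    have := mul_pos hδ (mul_pos (show 0 < -(crossing τ δ s₂ q₂ + 1) by linarith)
      (show 0 < orb τ δ s₂ q₂ 0 - orb τ δ s₂ (q₂ + 1) 0 by linarith [h₂.last_lt]))
    linarith
  rw [orient_orb_eq] at k1 k2 f1 f2
  have y1 := orb_succ_one τ δ s₂ (q₂ + 1)
  have y0 := orb_succ_one τ δ s₂ q₂
  have e2 : (orb τ δ s₂ (q₂ + 1 + 1) 1 - orb τ δ s₂ (q₂ + 1) 1) * (crossing τ δ s₂ q₂ + 1)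
      + pivot τ δ s₂ (q₂ + 1) = 0 := by
    rw [p2, y1, y0]; ring
  -- Here `V` is the outer crossing point and `E` its image; `k` is the exit edge, through `V` and
  -- `F`, and `k'` the next edge, through `F` and `E`.
  have := functional_nonneg_of_inside (v := crossing τ δ s₂ q₂) (w := crossing τ δ s₂ q₂ + 1)
    (h₂.crossing_neg hδ) (by linarith) h₂.leave (h₂.exit_one_nonpos hδ)
    h₁.leave (h₁.exit_one_nonpos hδ)
    (k := (orb τ δ s₂ (q₂ + 1) 1 - orb τ δ s₂ q₂ 1,
      -(orb τ δ s₂ (q₂ + 1) 0 - orb τ δ s₂ q₂ 0), pivot τ δ s₂ q₂))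
    (k' := (orb τ δ s₂ (q₂ + 1 + 1) 1 - orb τ δ s₂ (q₂ + 1) 1,
      -(orb τ δ s₂ (q₂ + 1 + 1) 0 - orb τ δ s₂ (q₂ + 1) 0), pivot τ δ s₂ (q₂ + 1)))
    (l0 := -c) (l1 := -(c + 1)) (l2 := c * (c + 1))
    p1 (by simp only; linear_combination v1) (by simp only; linear_combination f1)
    (by simp only; linarith) p3 (by simp only; linear_combination e2)
    (by simp only; linear_combination f2)
    (by simp only; linarith) (by nlinarith) (by nlinarith)
    (by simp only [side] at hF; linarith) (by nlinarith)
  simp only [side]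
  linarith

/-- The first exit point of an outer orbit is on the outer side of a line that has the first exit
of an inner orbit on its outer side. -/
theorem side_exit_nonpos (hδ : 0 < δ) (h₁ : Exits τ δ s₁ q₁) (h₂ : Exits τ δ s₂ q₂)
    (hs : s₁ ≤ s₂) {c : ℝ} (hc : c ≤ -1) (hu : crossing τ δ s₁ q₁ ≤ c)
    (hu1 : crossing τ δ s₁ q₁ < -1)
    (hF : side c (orb τ δ s₁ (q₁ + 1)) ≤ 0) : side c (orb τ δ s₂ (q₂ + 1)) ≤ 0 := by
  have hq := h₁.le_of_le hδ h₂ hs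
  have ht := h₁.turn_pos hδ
  set v := crossing τ δ s₁ q₁ with hv
  have hlast := h₁.last_lt
  obtain ⟨t, ht0, ht1, e⟩ := h₁.crossing_eq_iterate
  have hV0 := side_mix_nonneg (τ := τ) (δ := δ) h₁.nonneg le_rfl ht0 ht1
  have hVm : ∀ m ≤ q₁ + 1, 0 ≤ side s₁ ((affStep τ δ)^[m]
      (mix t (orb τ δ s₁ 0) (orb τ δ s₁ 1))) := by
    intro m hm
    refine side_iterate_nonneg h₁.nonneg ht hV0 m fun i hi => ?_
    rcases (show i ≤ q₁ by omega).eq_or_lt with rfl | hlt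
    · rw [← e]; simp
    · exact h₁.mix_stay ht0 ht1 hlt
  -- The separating line is edge `q₂ + 1` of the inner orbit: the number of steps is that of the
  -- outer orbit, because the outer exit point is the image of `(0, s₂)`, which lies outside the
  -- first inner line.
  have hp : 0 < pivot τ δ s₁ (q₂ + 1) := by
    rcases hq.eq_or_lt with heq | hlt
    · rw [heq, h₁.pivot_succ_eq]
      have := mul_pos hδ (mul_pos (show 0 < -(crossing τ δ s₁ q₁ + 1) by linarith)
        (show 0 < orb τ δ s₁ q₁ 0 - orb τ δ s₁ (q₁ + 1) 0 by linarith))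
      linarith
    · exact h₁.pivot_pos hδ (by omega) (by omega)
  have kF := h₁.orient_exit_nonneg hδ h₁ le_rfl (k := q₂ + 1) (by omega)
  have kG : orient (orb τ δ s₁ (q₂ + 1)) (orb τ δ s₁ (q₂ + 1 + 1)) (orb τ δ s₂ (q₂ + 1)) ≤ 0 := by
    have := orient_orb_iterate τ δ s₁ (q₂ + 1) (orb τ δ s₂ 0)
    rw [← orb_add, add_zero] at this
    rw [this]
    have h0 : side s₁ (orb τ δ s₂ 0) ≤ 0 := by
      simp [side]; nlinarith [h₁.nonneg]
    exact mul_nonpos_of_nonneg_of_nonpos (by positivity) h0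
  have kE : 0 ≤ orient (orb τ δ s₁ (q₂ + 1)) (orb τ δ s₁ (q₂ + 1 + 1)) !₂[v + 1, 0] := by
    have e' : !₂[v + 1, 0] = (affStep τ δ)^[q₂ + 1] ((affStep τ δ)^[q₁ - q₂]
        (mix t (orb τ δ s₁ 0) (orb τ δ s₁ 1))) := by
      rw [← Function.iterate_add_apply, show q₂ + 1 + (q₁ - q₂) = q₁ + 1 by omega,
        Function.iterate_succ_apply', ← e]
      apply plane_ext <;> simp [hv]
    rw [e', orient_orb_iterate]
    have := hVm (q₁ - q₂) (by omega)
    positivity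
  -- If both orbits leave at the same step, the edge is the one after the inner exit edge and cannot
  -- be pulled back from `V`; instead `V` is a mixture of two orbit points that are on its inner
  -- side.
  have kV : 0 ≤ orient (orb τ δ s₁ (q₂ + 1)) (orb τ δ s₁ (q₂ + 1 + 1)) !₂[0, v] := by
    rcases hq.eq_or_lt with heq | hlt
    · obtain ⟨t', ht0', ht1', e'⟩ := h₁.crossing_eq_mix
      have hcyc : orient (orb τ δ s₁ (q₁ + 1)) (orb τ δ s₁ (q₁ + 1 + 1)) (orb τ δ s₁ q₁)
          = δ ^ q₁ * side s₁ (orb τ δ s₁ 2) := by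
        rw [← orient_orb_iterate, ← orb_add]
        simp only [orient]
        ring
      rw [heq, hv, e', orient_mix, orient_self_left, hcyc]
      have : 0 ≤ 1 - t' := by linarith
      positivity
    · rw [hv, e, show q₁ = q₂ + 1 + (q₁ - (q₂ + 1)) by omega, Function.iterate_add_apply,
        orient_orb_iterate]
      have := hVm (q₁ - (q₂ + 1)) (by omega)
      positivity
  rw [orient_orb_eq] at kF kG kE kV
  simp at kE kV
  have := functional_nonpos_of_outside (v := v) (w := v + 1)
    (h₁.crossing_neg hδ) (by linarith) h₁.leave (h₁.exit_one_nonpos hδ)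
    h₂.leave (h₂.exit_one_nonpos hδ)
    (k0 := orb τ δ s₁ (q₂ + 1 + 1) 1 - orb τ δ s₁ (q₂ + 1) 1)
    (k1 := -(orb τ δ s₁ (q₂ + 1 + 1) 0 - orb τ δ s₁ (q₂ + 1) 0)) (k2 := pivot τ δ s₁ (q₂ + 1))
    (l0 := -c) (l1 := -(c + 1)) (l2 := c * (c + 1)) hp (by linarith) (by linarith) (by linarith)
    (by linarith) (by nlinarith) (by nlinarith) (by simp only [side] at hF; linarith) (by nlinarith)
  simp only [side]
  linarith

end comparison
end Exits
end

/-! ### Passage through the right half-plane. -/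

noncomputable section

variable {τ δ : ℝ}

theorem side_vertical (c u : ℝ) : side c !₂[0, u] = (c + 1) * (c - u) := by simp [side]; ring

theorem side_horizontal (c u : ℝ) : side c !₂[u + 1, 0] = c * (c - u) := by simp [side]; ring

theorem affStep_vertical (u : ℝ) : affStep τ δ !₂[0, u] = !₂[u + 1, 0] := by
  apply plane_ext <;> simp

theorem orb_mix_eq_crossing_mix {s : ℝ} {q : ℕ} (h : Exits τ δ s q) {r : ℝ}
    (hr1 : r ≤ 1) (hx : mix r (orb τ δ s q) (orb τ δ s (q + 1)) 0 ≤ 0) :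
    ∃ μ : ℝ, 0 ≤ μ ∧ μ ≤ 1 ∧ mix r (orb τ δ s q) (orb τ δ s (q + 1))
      = mix μ !₂[0, crossing τ δ s q] (orb τ δ s (q + 1)) := by
  have h1 := h.leave
  have h2 := h.last_lt
  have h3 := h.stay q le_rfl
  have hc := h.crossing_mul
  simp at hx
  set a := orb τ δ s q 0
  set b := orb τ δ s (q + 1) 0
  have hb := h1.ne
  refine ⟨((1 - r) * a + r * b) / b, div_nonneg_of_nonpos hx h1.le, ?_, ?_⟩
  · rw [div_le_one_of_neg h1]; nlinarith
  · apply plane_ext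
    · simp
      field_simp
      change ((1 - r) * a + r * b) * b = b * ((1 - r) * a + r * b)
      ring
    · simp
      field_simp
      have : pivot τ δ s q = b * orb τ δ s q 1 - orb τ δ s (q + 1) 1 * a := rfl
      rw [this] at hc
      linear_combination (1 - r) * hc

theorem orb_mix_eq_mix_crossing {s : ℝ} {q : ℕ} (h : Exits τ δ s q) {r : ℝ} (hr0 : 0 ≤ r)
    (hx : 0 ≤ mix r (orb τ δ s q) (orb τ δ s (q + 1)) 0) :
    ∃ μ : ℝ, 0 ≤ μ ∧ μ ≤ 1 ∧ mix r (orb τ δ s q) (orb τ δ s (q + 1))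
      = mix μ (orb τ δ s q) !₂[0, crossing τ δ s q] := by
  have h1 := h.leave
  have h2 := h.last_lt
  have h3 := h.stay q le_rfl
  have hc := h.crossing_mul
  have hp : pivot τ δ s q
    = orb τ δ s (q + 1) 0 * orb τ δ s q 1 - orb τ δ s (q + 1) 1 * orb τ δ s q 0 := rfl
  simp at hx
  set a := orb τ δ s q 0
  set b := orb τ δ s (q + 1) 0
  rcases h3.eq_or_lt with h0 | hpos
  -- If the last right-hand orbit point is on the axis itself, every other point of the edge is
  -- strictly left, so only this endpoint is possible.
  · have hr : r = 0 := by nlinarith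
    refine ⟨0, le_rfl, zero_le_one, ?_⟩
    apply plane_ext <;> simp [hr]
  · have ha := hpos.ne'
    refine ⟨r * (a - b) / a, ?_, ?_, ?_⟩
    · have : 0 < a - b := by linarith
      positivity
    · rw [div_le_one hpos]; nlinarith
    · apply plane_ext
      · simp
        field_simp
        change ((1 - r) * a + r * b) * a = a * (a - r * (a - b))
        ring
      · simp
        field_simp
        rw [hp] at hc
        linear_combination -r * hc

/-- The first exit of an outer orbit `s₂` is inside a line with parameter `c`, and the first exit
of an inner orbit `s₁` is outside a line with parameter `c'`. -/
structure Barrier (τ δ s₁ s₂ : ℝ) (q₁ q₂ : ℕ) (c' c : ℝ) : Prop where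
  inner : Exits τ δ s₁ q₁
  outer : Exits τ δ s₂ q₂
  le : s₁ ≤ s₂
  param : c ≤ -1
  param' : c' ≤ -1
  crossing_inner : crossing τ δ s₁ q₁ < c'
  crossing_outer : c < crossing τ δ s₂ q₂
  exit_inner : side c' (orb τ δ s₁ (q₁ + 1)) ≤ 0
  exit_outer : 0 ≤ side c (orb τ δ s₂ (q₂ + 1))

theorem Barrier.exists_exit (hδ : 0 < δ) {s₁ s₂ c' c : ℝ} {q₁ q₂ : ℕ}
    (B : Barrier τ δ s₁ s₂ q₁ q₂ c' c) {s r : ℝ} (hs1 : s₁ ≤ s) (hs2 : s ≤ s₂) (hr0 : 0 ≤ r)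
    (hr1 : r ≤ 1) :
    ∃ n, 1 ≤ n ∧ q₂ ≤ n ∧ n ≤ q₁ + 1 ∧
      (∀ j < n, 0 ≤ (affStep τ δ)^[j] (mix r (orb τ δ s 0) (orb τ δ s 1)) 0) ∧
      (affStep τ δ)^[n] (mix r (orb τ δ s 0) (orb τ δ s 1)) 0 < 0 ∧
      0 ≤ side c ((affStep τ δ)^[n] (mix r (orb τ δ s 0) (orb τ δ s 1))) ∧
      side c' ((affStep τ δ)^[n] (mix r (orb τ δ s 0) (orb τ δ s 1))) ≤ 0 := by
  obtain ⟨h₁, h₂, -, hc, hc', hu₁, hu₂, hF₁, hF₂⟩ := B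
  obtain ⟨q, hq1, h⟩ := h₁.exists_of_le hδ hs1
  have hq2 := h.le_of_le hδ h₂ hs2
  have hq0 := h.one_le
  have hc1 := h₁.crossing_le hδ h hs1
  have hc2 := h.crossing_le hδ h₂ hs2
  have hF := h.side_exit_nonneg hδ h₂ hs2 hc hu₂.le (by linarith) hF₂
  have hF' := h₁.side_exit_nonpos hδ h hs1 hc' hu₁.le (by linarith) hF₁
  set W := mix r (orb τ δ s 0) (orb τ δ s 1) with hW
  have hit : (affStep τ δ)^[q] W = mix r (orb τ δ s q) (orb τ δ s (q + 1)) := by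
    rw [hW, affStep_iterate_mix, ← orb_add, ← orb_add, add_zero]
  have hU : 0 ≤ side c !₂[0, crossing τ δ s q] := by rw [side_vertical]; nlinarith
  have hU' : side c' !₂[0, crossing τ δ s q] ≤ 0 := by rw [side_vertical]; nlinarith
  have hE : 0 ≤ side c !₂[crossing τ δ s q + 1, 0] := by rw [side_horizontal]; nlinarith
  have hE' : side c' !₂[crossing τ δ s q + 1, 0] ≤ 0 := by rw [side_horizontal]; nlinarith
  have comb : ∀ {μ a b : ℝ}, 0 ≤ μ → μ ≤ 1 → 0 ≤ a → 0 ≤ b → 0 ≤ (1 - μ) * a + μ * b :=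
    fun h0 h1 ha hb => add_nonneg (mul_nonneg (by linarith) ha) (mul_nonneg h0 hb)
  have comb' : ∀ {μ a b : ℝ}, 0 ≤ μ → μ ≤ 1 → a ≤ 0 → b ≤ 0 → (1 - μ) * a + μ * b ≤ 0 :=
    fun h0 h1 ha hb => add_nonpos (mul_nonpos_of_nonneg_of_nonpos (by linarith) ha)
      (mul_nonpos_of_nonneg_of_nonpos h0 hb)
  -- After `q` steps the point is on the exit edge. If it is already left of the axis it lies
  -- between the crossing and the exit point; otherwise one more step puts it between the exit point
  -- and the image of the crossing. This alternative is the reason for the `+ 1` in `q_max`.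
  by_cases hx : mix r (orb τ δ s q) (orb τ δ s (q + 1)) 0 < 0
  · obtain ⟨μ, h0, h1, e⟩ := orb_mix_eq_crossing_mix h hr1 hx.le
    refine ⟨q, hq0, hq2, by omega, fun j hj => h.mix_stay hr0 hr1 hj, by rw [hit]; exact hx, ?_, ?_⟩
    · rw [hit, e, side_mix]
      exact comb h0 h1 hU hF
    · rw [hit, e, side_mix]
      exact comb' h0 h1 hU' hF'
  · push Not at hx
    obtain ⟨μ, h0, h1, e⟩ := orb_mix_eq_mix_crossing h hr0 hx
    have hit' : (affStep τ δ)^[q + 1] W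
        = mix μ (orb τ δ s (q + 1)) !₂[crossing τ δ s q + 1, 0] := by
      rw [Function.iterate_succ_apply', hit, e, affStep_mix, ← orb_succ, affStep_vertical]
    refine ⟨q + 1, by omega, by omega, by omega, ?_, ?_, ?_, ?_⟩
    · intro j hj
      rcases (show j ≤ q by omega).eq_or_lt with rfl | hlt
      · rw [hit]; exact hx
      · exact h.mix_stay hr0 hr1 hlt
    · rw [hit', mix_apply_zero]
      have := h.leave
      have e0 : (!₂[crossing τ δ s q + 1, 0] : Plane) 0 = crossing τ δ s q + 1 := by simp
      rw [e0]
      rcases h0.eq_or_lt with rfl | hpos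
      · simpa using this
      · have h2 : crossing τ δ s q + 1 < 0 := by linarith
        have h3 := mul_neg_of_pos_of_neg hpos h2
        have h4 := mul_nonpos_of_nonneg_of_nonpos (show 0 ≤ 1 - μ by linarith) this.le
        linarith
    · rw [hit', side_mix]
      exact comb h0 h1 hF hE
    · rw [hit', side_mix]
      exact comb' h0 h1 hF' hE'

/-- Every point of the first quadrant between the lines with parameters `s₁` and `s₂` lies on the
segment with some parameter in between. -/
theorem exists_mix_eq {s₁ s₂ : ℝ} {W : Plane} (h0 : 0 ≤ s₁) (h12 : s₁ ≤ s₂) (hW0 : 0 ≤ W 0)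
    (hW1 : 0 ≤ W 1) (h1 : side s₁ W ≤ 0) (h2 : 0 ≤ side s₂ W)
    (hax : W 1 = 0 → s₁ + 1 ≤ W 0 ∧ 0 < s₂) :
    ∃ s r, s₁ ≤ s ∧ s ≤ s₂ ∧ 0 ≤ r ∧ r ≤ 1 ∧ W = mix r (orb τ δ s 0) (orb τ δ s 1) := by
  rcases hW1.eq_or_lt with hz | hpos
  -- On the horizontal axis `side s W` has the spurious root `s = 0`, so the parameter is read off
  -- from the abscissa instead of the intermediate value theorem.
  · obtain ⟨h3, h4⟩ := hax hz.symm
    refine ⟨W 0 - 1, 1, by linarith, ?_, zero_le_one, le_rfl, ?_⟩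
    · simp only [side, ← hz] at h2
      by_contra hc
      push Not at hc
      nlinarith
    · apply plane_ext <;> simp [← hz]
  · have hcont : ContinuousOn (fun s => side s W) (Set.Icc s₁ s₂) := by
      unfold side; fun_prop
    obtain ⟨s, ⟨ha, hb⟩, hs⟩ := intermediate_value_Icc h12 hcont ⟨h1, h2⟩
    have hs0 : 0 ≤ s := h0.trans ha
    have hs' : side s W = 0 := hs
    simp only [side] at hs'
    have e : W 1 * (s + 1) = s * (s + 1 - W 0) := by linear_combination -hs'
    have hs1 : s + 1 ≠ 0 := by linarith
    refine ⟨s, W 0 / (s + 1), ha, hb, by positivity, ?_, ?_⟩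
    · rw [div_le_one (by linarith)]
      by_contra hc
      push Not at hc
      nlinarith [mul_pos hpos (show 0 < s + 1 by linarith)]
    · apply plane_ext
      · simp; field_simp
      · simp; field_simp; linarith
end

noncomputable section

variable {τ δ : ℝ}

/-! ### First passage through the left half-plane -/

theorem affStep_iterate_zero (Z : Plane) (n : ℕ) :
    (affStep τ δ)^[n] Z 0
      = lucasSeq τ δ (n + 1) * Z 0 + lucasSeq τ δ n * Z 1 + lucasSum τ δ n := by
  induction n using Nat.twoStepInduction with
  | zero => simp [lucasSeq, lucasSum]
  | one => simp [lucasSeq, lucasSum]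
  | more n h1 h2 =>
    rw [Function.iterate_succ_apply', affStep_zero, h2, Function.iterate_succ_apply', affStep_one,
      h1, lucasSum_rec]
    simp only [lucasSeq]
    ring

theorem affStep_iterate_succ_one (Z : Plane) (n : ℕ) :
    (affStep τ δ)^[n + 1] Z 1 = -δ * (affStep τ δ)^[n] Z 0 := by
  rw [Function.iterate_succ_apply', affStep_one]

/-- The Cassini identity, in other words the determinant of the matrix power. -/
theorem lucasSeq_sq (n : ℕ) :
    lucasSeq τ δ (n + 1) ^ 2 - lucasSeq τ δ (n + 2) * lucasSeq τ δ n = δ ^ n := by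
  induction n with
  | zero => simp [lucasSeq]
  | succ n ih =>
    have e1 : lucasSeq τ δ (n + 3) = τ * lucasSeq τ δ (n + 2) - δ * lucasSeq τ δ (n + 1) := rfl
    have e2 : lucasSeq τ δ (n + 2) = τ * lucasSeq τ δ (n + 1) - δ * lucasSeq τ δ n := rfl
    rw [pow_succ δ n, ← ih, e1]
    linear_combination lucasSeq τ δ (n + 2) * e2

/-- The convolution `∑ δ^j s_{n-1-j}`. -/
def lucasConv (τ δ : ℝ) : ℕ → ℝ
  | 0 => 0
  | n + 1 => lucasSeq τ δ n + δ * lucasConv τ δ n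

theorem lucasConv_eq (n : ℕ) :
    lucasConv τ δ (n + 1)
      = lucasSum τ δ (n + 1) * lucasSeq τ δ n - lucasSum τ δ n * lucasSeq τ δ (n + 1) := by
  induction n with
  | zero => simp [lucasConv, lucasSeq, lucasSum]
  | succ n ih =>
    rw [lucasConv, ih, lucasSum_rec, lucasSeq]
    ring

theorem lucasConv_rec (n : ℕ) :
    lucasConv τ δ (n + 2) = τ * lucasConv τ δ (n + 1) - δ * lucasConv τ δ n + δ ^ n := by
  induction n with
  | zero => simp [lucasConv, lucasSeq]
  | succ n ih =>
    have e : lucasConv τ δ (n + 3) = lucasSeq τ δ (n + 2) + δ * lucasConv τ δ (n + 2) := rfl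
    have e2 : lucasConv τ δ (n + 2) = lucasSeq τ δ (n + 1) + δ * lucasConv τ δ (n + 1) := rfl
    have e3 : lucasConv τ δ (n + 1) = lucasSeq τ δ n + δ * lucasConv τ δ n := rfl
    have e4 : lucasSeq τ δ (n + 2) = τ * lucasSeq τ δ (n + 1) - δ * lucasSeq τ δ n := rfl
    rw [pow_succ]
    linear_combination e + δ * ih + e4 - τ * e2 + δ * e3

/-- The iterate inverted: the starting abscissa as an affine function of the end point. Its zero set
is the image of the vertical axis, with axis intercepts `endHeight n + 1` (for `n ≥ 1`) and
`endHeight (n + 1)` when the Lucas terms are nonzero. -/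
theorem apply_zero_of_iterate (Z : Plane) (n : ℕ) :
    δ ^ (n + 1) * Z 0 = -δ * lucasSeq τ δ n * (affStep τ δ)^[n + 1] Z 0
      - lucasSeq τ δ (n + 1) * (affStep τ δ)^[n + 1] Z 1 + δ * lucasConv τ δ (n + 1) := by
  induction n with
  | zero => simp [lucasSeq, lucasConv]
  | succ n ih =>
    have e1 : lucasConv τ δ (n + 1 + 1)
      = lucasSeq τ δ (n + 1) + δ * lucasConv τ δ (n + 1) := rfl
    have e2 : lucasSeq τ δ (n + 1 + 1) = τ * lucasSeq τ δ (n + 1) - δ * lucasSeq τ δ n := rfl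
    rw [pow_succ, mul_comm (δ ^ (n + 1)) δ, mul_assoc, ih,
      Function.iterate_succ_apply' _ (n + 1), affStep_zero, affStep_one, e1, e2]
    ring

/-- The height of the point of the vertical axis that reaches the axis again after `n` steps. -/
def startHeight (τ δ : ℝ) (n : ℕ) : ℝ := -lucasSum τ δ n / lucasSeq τ δ n

/-- The height at which the orbit of `(0, startHeight n)` reaches the axis again. -/
def endHeight (τ δ : ℝ) (n : ℕ) : ℝ := δ * lucasConv τ δ n / lucasSeq τ δ n

/-- The terms `s_1, …, s_P` are positive. -/
def LucasPos (τ δ : ℝ) (P : ℕ) : Prop := ∀ i, 1 ≤ i → i ≤ P → 0 < lucasSeq τ δ i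

theorem orb_startHeight {n : ℕ} (hn : 1 ≤ n) (hs : lucasSeq τ δ n ≠ 0) :
    orb τ δ (startHeight τ δ n) n = !₂[0, endHeight τ δ n] := by
  obtain ⟨k, rfl⟩ : ∃ k, n = k + 1 := ⟨n - 1, by omega⟩
  apply plane_ext
  · rw [orb_apply_zero, startHeight]
    simp
    field_simp
    ring
  · rw [orb_succ_one, orb_apply_zero, startHeight]
    simp [endHeight]
    field_simp
    rw [lucasConv_eq]
    ring

/-- The `n`-step map carries the line through `(0, startHeight n)` and its image to the line through
`(0, endHeight n)` and its image, and scales signed areas by `δ ^ n`. -/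
theorem side_endHeight {n : ℕ} (hn : 1 ≤ n) (hs : lucasSeq τ δ n ≠ 0) (Z : Plane) :
    side (endHeight τ δ n) ((affStep τ δ)^[n] Z) = δ ^ n * side (startHeight τ δ n) Z := by
  rw [← orient_orb_iterate, orb_succ, orb_startHeight hn hs, affStep_vertical]
  simp [side, orient]
  ring

theorem side_startHeight {n : ℕ} (hs : lucasSeq τ δ (n + 1) ≠ 0) (Z : Plane) :
    lucasSeq τ δ (n + 1) ^ 2 * side (startHeight τ δ (n + 1)) Z
      = lucasSum τ δ (n + 1) * lucasSeq τ δ (n + 1) * Z 0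
        + lucasSum τ δ n * lucasSum τ δ (n + 1)
        + lucasSum τ δ n * lucasSeq τ δ (n + 1) * Z 1 := by
  have e : startHeight τ δ (n + 1) + 1 = -lucasSum τ δ n / lucasSeq τ δ (n + 1) := by
    rw [startHeight, lucasSum]; field_simp; ring
  rw [side, e, startHeight]
  field_simp
  ring

namespace LucasPos

variable {P : ℕ}

theorem seq_nonneg (h : LucasPos τ δ P) {n : ℕ} (hn : n ≤ P) : 0 ≤ lucasSeq τ δ n := by
  rcases n with _ | n
  · simp [lucasSeq]
  · exact (h _ (by omega) hn).le

theorem sum_nonneg (h : LucasPos τ δ P) {n : ℕ} (hn : n ≤ P) : 0 ≤ lucasSum τ δ n := by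
  induction n with
  | zero => simp [lucasSum]
  | succ n ih => rw [lucasSum]; exact add_nonneg (ih (by omega)) (h.seq_nonneg hn)

theorem sum_pos (h : LucasPos τ δ P) {n : ℕ} (hn1 : 1 ≤ n) (hn : n ≤ P) : 0 < lucasSum τ δ n := by
  obtain ⟨k, rfl⟩ : ∃ k, n = k + 1 := ⟨n - 1, by omega⟩
  rw [lucasSum]
  exact add_pos_of_nonneg_of_pos (h.sum_nonneg (by omega)) (h _ (by omega) hn)

theorem conv_nonneg (hδ : 0 < δ) (h : LucasPos τ δ P) {n : ℕ} (hn : n ≤ P + 1) :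
    0 ≤ lucasConv τ δ n := by
  induction n with
  | zero => simp [lucasConv]
  | succ n ih =>
    rw [lucasConv]
    exact add_nonneg (h.seq_nonneg (by omega)) (mul_nonneg hδ.le (ih (by omega)))

theorem conv_pos (hδ : 0 < δ) (h : LucasPos τ δ P) {n : ℕ} (hn2 : 2 ≤ n) (hn : n ≤ P + 1) :
    0 < lucasConv τ δ n := by
  obtain ⟨k, rfl⟩ : ∃ k, n = k + 1 := ⟨n - 1, by omega⟩
  rw [lucasConv]
  exact add_pos_of_pos_of_nonneg (h _ (by omega) (by omega))
    (mul_nonneg hδ.le (h.conv_nonneg hδ (by omega)))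

theorem endHeight_nonneg (hδ : 0 < δ) (h : LucasPos τ δ P) {n : ℕ} (hn : n ≤ P) :
    0 ≤ endHeight τ δ n :=
  div_nonneg (mul_nonneg hδ.le (h.conv_nonneg hδ (by omega))) (h.seq_nonneg hn)

theorem endHeight_pos (hδ : 0 < δ) (h : LucasPos τ δ P) {n : ℕ} (hn2 : 2 ≤ n) (hn : n ≤ P) :
    0 < endHeight τ δ n :=
  div_pos (mul_pos hδ (h.conv_pos hδ hn2 (by omega))) (h _ (by omega) hn)

/-- A Casoratian: the two sequences satisfy the same recursion except for the forcing term `δ ^ n`,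
which adds a positive amount at each step. It is the numerator of the monotonicity of `endHeight`.
-/
theorem conv_cross_nonneg (hδ : 0 < δ) (h : LucasPos τ δ P) {n : ℕ} (hn : n ≤ P) :
    0 ≤ lucasConv τ δ (n + 1) * lucasSeq τ δ n - lucasConv τ δ n * lucasSeq τ δ (n + 1) := by
  induction n with
  | zero => simp [lucasConv, lucasSeq]
  | succ n ih =>
    have h1 := ih (by omega)
    have h2 := h (n + 1) (by omega) hn
    have e : lucasConv τ δ (n + 1 + 1) * lucasSeq τ δ (n + 1)
        - lucasConv τ δ (n + 1) * lucasSeq τ δ (n + 1 + 1)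
        = δ * (lucasConv τ δ (n + 1) * lucasSeq τ δ n - lucasConv τ δ n * lucasSeq τ δ (n + 1))
          + δ ^ n * lucasSeq τ δ (n + 1) := by
      rw [lucasConv_rec, lucasSeq]; ring
    rw [e]
    positivity

theorem endHeight_mono (hδ : 0 < δ) (h : LucasPos τ δ P) {a b : ℕ} (ha : 1 ≤ a) (hab : a ≤ b)
    (hb : b ≤ P) : endHeight τ δ a ≤ endHeight τ δ b := by
  induction b, hab using Nat.le_induction with
  | base => exact le_rfl
  | succ n hn ih =>
    refine (ih (by omega)).trans ?_
    have h1 := h n (by omega) (by omega)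
    have h2 := h (n + 1) (by omega) (by omega)
    have h3 := h.conv_cross_nonneg hδ (n := n) (by omega)
    rw [endHeight, endHeight, div_le_div_iff₀ h1 h2]
    nlinarith

theorem endHeight_add_one (h : LucasPos τ δ P) {n : ℕ} (hn1 : 1 ≤ n) (hn : n ≤ P) :
    (endHeight τ δ n + 1) * lucasSeq τ δ n = lucasConv τ δ (n + 1) := by
  have := (h n hn1 hn).ne'
  rw [endHeight, lucasConv]
  field_simp
  ring

theorem endHeight_mul (h : LucasPos τ δ P) {n : ℕ} (hn1 : 1 ≤ n) (hn : n ≤ P) :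
    endHeight τ δ n * lucasSeq τ δ n = δ * lucasConv τ δ n := by
  have := (h n hn1 hn).ne'
  rw [endHeight]
  field_simp

/-- An orbit that is still to the left of the axis has been strictly to the left before. -/
theorem iterate_neg_of_succ (hδ : 0 < δ) (h : LucasPos τ δ P) {m : ℕ} (hm : m + 1 ≤ P) {Z : Plane}
    (hZ0 : Z 0 ≤ 0) (hor : Z 0 < 0 ∨ 1 ≤ m) (h1 : (affStep τ δ)^[m + 1] Z 0 ≤ 0) :
    (affStep τ δ)^[m] Z 0 < 0 := by
  have hs1 := h (m + 1) (by omega) (by omega)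
  have hs0 := h.seq_nonneg (n := m) (by omega)
  have e1 := lucasSeq_sq (τ := τ) (δ := δ) m
  have e2 := lucasConv_eq (τ := τ) (δ := δ) m
  -- Eliminating the ordinate between two consecutive abscissas leaves a quantity that is positive
  -- whatever the ordinate is.
  have e3 : (affStep τ δ)^[m + 1] Z 0 * lucasSeq τ δ m
      - (affStep τ δ)^[m] Z 0 * lucasSeq τ δ (m + 1) = -Z 0 * δ ^ m + lucasConv τ δ (m + 1) := by
    rw [affStep_iterate_zero, affStep_iterate_zero, ← e1, e2]; ring
  have h5 : 0 < -Z 0 * δ ^ m + lucasConv τ δ (m + 1) := by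
    rcases hor with hlt | hm1
    · have := h.conv_nonneg hδ (n := m + 1) (by omega)
      have := mul_pos (neg_pos.2 hlt) (pow_pos hδ m)
      linarith
    · have := h.conv_pos hδ (n := m + 1) (by omega) (by omega)
      have := mul_nonneg (neg_nonneg.2 hZ0) (pow_pos hδ m).le
      linarith
  have h6 := mul_nonpos_of_nonpos_of_nonneg h1 hs0
  by_contra hX
  push Not at hX
  have := mul_nonneg hX hs1.le
  linarith

/-- A point of the third quadrant below the `T`-line has not crossed the axis before step `T`. -/
theorem iterate_nonpos (hδ : 0 < δ) (h : LucasPos τ δ P) {T : ℕ} (hT1 : 1 ≤ T) (hTP : T ≤ P)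
    {Z : Plane} (hZ0 : Z 0 < 0) (hZ1 : Z 1 ≤ 0) (hT : side (startHeight τ δ T) Z ≤ 0) :
    ∀ i < T, (affStep τ δ)^[i] Z 0 ≤ 0 := by
  obtain ⟨k, rfl⟩ : ∃ k, T = k + 1 := ⟨T - 1, by omega⟩
  have hsT := h (k + 1) (by omega) hTP
  have hk : (affStep τ δ)^[k] Z 0 ≤ 0 := by
    rcases k with _ | k
    · exact hZ0.le
    · have hS := h.sum_pos (n := k + 1) (by omega) (by omega)
      have hs := h (k + 1) (by omega) (by omega)
      rw [affStep_iterate_zero]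
      -- Since `Z 1 ≤ 0`, a positive abscissa needs this part to be positive; in that case the
      -- ordinate is eliminated with the `T`-line.
      by_cases hc : 0 ≤ lucasSeq τ δ (k + 1 + 1) * Z 0 + lucasSum τ δ (k + 1)
      · have e1 := side_startHeight hsT.ne' Z
        have e2 := lucasConv_eq (τ := τ) (δ := δ) (k + 1)
        have h4 := h.conv_pos hδ (n := k + 1 + 1) (by omega) (by omega)
        set X := lucasSeq τ δ (k + 1 + 1) * Z 0 + lucasSeq τ δ (k + 1) * Z 1
          + lucasSum τ δ (k + 1)
        have e3 : lucasSum τ δ (k + 1) * lucasSeq τ δ (k + 1 + 1) * X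
            = lucasSeq τ δ (k + 1) * (lucasSeq τ δ (k + 1 + 1) ^ 2 *
                side (startHeight τ δ (k + 1 + 1)) Z)
              - lucasConv τ δ (k + 1 + 1) *
                (lucasSeq τ δ (k + 1 + 1) * Z 0 + lucasSum τ δ (k + 1)) := by
          rw [e1, e2]; ring
        have e4 : lucasSum τ δ (k + 1) * lucasSeq τ δ (k + 1 + 1) * X ≤ 0 := by
          rw [e3]
          have a1 : lucasSeq τ δ (k + 1) * (lucasSeq τ δ (k + 1 + 1) ^ 2 *
                side (startHeight τ δ (k + 1 + 1)) Z) ≤ 0 :=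
            mul_nonpos_of_nonneg_of_nonpos hs.le
              (mul_nonpos_of_nonneg_of_nonpos (by positivity) hT)
          have a2 := mul_nonneg h4.le hc
          linarith
        by_contra hX
        push Not at hX
        have := mul_pos (mul_pos hS hsT) hX
        linarith
      · push Not at hc
        nlinarith [mul_nonneg hs.le (neg_nonneg.2 hZ1)]
  have hdown : ∀ j ≤ k, (affStep τ δ)^[k - j] Z 0 ≤ 0 := by
    intro j
    induction j with
    | zero => intro _; exact hk
    | succ j ih =>
      intro hj
      have h1 := ih (by omega)
      obtain ⟨m, hm⟩ : ∃ m, m = k - (j + 1) := ⟨_, rfl⟩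
      rw [show k - j = m + 1 by omega] at h1
      rw [← hm]
      exact (h.iterate_neg_of_succ hδ (by omega) hZ0.le (Or.inl hZ0) h1).le
  intro i hi
  have := hdown (k - i) (by omega)
  rwa [show k - (k - i) = i by omega] at this

/-- A point of the left half-plane to the right of the `P`-line has crossed the axis at step
`P`. -/
theorem iterate_pos (hδ : 0 < δ) (h : LucasPos τ δ P) (hP : 2 ≤ P) {Z : Plane} (hZ0 : Z 0 < 0)
    (hside : 0 ≤ side (startHeight τ δ P) Z) : 0 < (affStep τ δ)^[P] Z 0 := by
  obtain ⟨k, rfl⟩ : ∃ k, P = k + 1 := ⟨P - 1, by omega⟩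
  have hs := h (k + 1) (by omega) le_rfl
  have hS := h.sum_pos (n := k) (by omega) (by omega)
  have hN := h.conv_pos hδ (n := k + 2) (by omega) (by omega)
  have e1 := side_startHeight hs.ne' Z
  have e2 := lucasConv_eq (τ := τ) (δ := δ) (k + 1)
  have e0 : lucasSum τ δ (k + 1 + 1) = lucasSum τ δ (k + 1) + lucasSeq τ δ (k + 1 + 1) := rfl
  have e3 : lucasSum τ δ k * (affStep τ δ)^[k + 1] Z 0
      = lucasSeq τ δ (k + 1) ^ 2 * side (startHeight τ δ (k + 1)) Z
        - lucasConv τ δ (k + 1 + 1) * Z 0 := by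
    have e5 : lucasSum τ δ (k + 1) = lucasSum τ δ k + lucasSeq τ δ (k + 1) := rfl
    rw [e1, e2, e0, affStep_iterate_zero]
    linear_combination (-lucasSeq τ δ (k + 2) * Z 0) * e5
  have h1 : 0 ≤ lucasSeq τ δ (k + 1) ^ 2 * side (startHeight τ δ (k + 1)) Z := by positivity
  have h2 := mul_pos hN (neg_pos.2 hZ0)
  exact pos_of_mul_pos_right (by rw [e3]; linarith) hS.le

end LucasPos

theorem side_nonneg_of_intercepts {a b y : ℝ} {W : Plane} (hb : 0 < b) (ha : 0 < a) (hay : a ≤ y + 1)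
    (hby : b ≤ y) (hW0 : 0 ≤ W 0) (hW1 : 0 ≤ W 1) (h : b * W 0 + a * W 1 ≤ a * b) :
    0 ≤ side y W := by
  have hy : 0 < y := by linarith
  have h1 : W 0 / (y + 1) + W 1 / y ≤ W 0 / a + W 1 / b := by gcongr
  have h2 : W 0 / a + W 1 / b ≤ 1 := by
    rw [div_add_div _ _ ha.ne' hb.ne', div_le_one (by positivity)]; linarith
  have h3 := h1.trans h2
  rw [div_add_div _ _ (by positivity) hy.ne', div_le_one (by positivity)] at h3
  simp only [side]
  linarith

theorem side_nonpos_of_intercepts {a b y : ℝ} {W : Plane} (hy : 0 ≤ y) (hay : y + 1 ≤ a)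
    (hby : y ≤ b) (hW0 : 0 ≤ W 0) (hW1 : 0 ≤ W 1) (h : a * b ≤ b * W 0 + a * W 1) :
    side y W ≤ 0 := by
  rcases hy.eq_or_lt with rfl | hpos
  · simp [side]; exact hW1
  · have ha : 0 < a := by linarith
    have hb : 0 < b := by linarith
    have h1 : W 0 / a + W 1 / b ≤ W 0 / (y + 1) + W 1 / y := by gcongr
    have h2 : 1 ≤ W 0 / a + W 1 / b := by
      rw [div_add_div _ _ ha.ne' hb.ne', one_le_div (by positivity)]; linarith
    have h3 := h2.trans h1
    rw [div_add_div _ _ (by positivity) hpos.ne', one_le_div (by positivity)] at h3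
    simp only [side]
    linarith

/-- Points of the third quadrant between the `T`-line and the `P`-line first cross the axis after
`p` steps with `T ≤ p ≤ P`, and then lie between the images of these two lines. -/
theorem LucasPos.exists_first_crossing (hδ : 0 < δ) {T P : ℕ} (h : LucasPos τ δ P) (hT1 : 1 ≤ T)
    (hTP : T < P) {Z : Plane} (hZ0 : Z 0 < 0) (hZ1 : Z 1 ≤ 0)
    (hT : side (startHeight τ δ T) Z ≤ 0) (hP : 0 ≤ side (startHeight τ δ P) Z) :
    ∃ p, T ≤ p ∧ p ≤ P ∧ (∀ i < p, (affStep τ δ)^[i] Z 0 ≤ 0) ∧ 0 < (affStep τ δ)^[p] Z 0 ∧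
      0 ≤ (affStep τ δ)^[p] Z 1 ∧ side (endHeight τ δ T) ((affStep τ δ)^[p] Z) ≤ 0 ∧
      0 ≤ side (endHeight τ δ P) ((affStep τ δ)^[p] Z) ∧
      ((affStep τ δ)^[p] Z 1 = 0 → endHeight τ δ T + 1 ≤ (affStep τ δ)^[p] Z 0) := by
  classical
  have hPpos := h.iterate_pos hδ (by omega) hZ0 hP
  have hex : ∃ i, 0 < (affStep τ δ)^[i] Z 0 := ⟨P, hPpos⟩
  obtain ⟨p, hp⟩ : ∃ p, p = Nat.find hex := ⟨_, rfl⟩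
  have hpP : p ≤ P := hp ▸ Nat.find_min' hex hPpos
  have hpos : 0 < (affStep τ δ)^[p] Z 0 := hp ▸ Nat.find_spec hex
  have hlt : ∀ i < p, (affStep τ δ)^[i] Z 0 ≤ 0 := fun i hi =>
    not_lt.1 (Nat.find_min hex (hp ▸ hi))
  have hTp : T ≤ p := by
    by_contra hc
    exact absurd (h.iterate_nonpos hδ hT1 hTP.le hZ0 hZ1 hT p (by omega)) (not_le.2 hpos)
  obtain ⟨k, rfl⟩ : ∃ k, p = k + 1 := ⟨p - 1, by omega⟩
  set W := (affStep τ δ)^[k + 1] Z with hW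
  have hW1e : W 1 = -δ * (affStep τ δ)^[k] Z 0 := affStep_iterate_succ_one Z k
  have hW1 : 0 ≤ W 1 := by rw [hW1e]; nlinarith [hlt k (by omega)]
  have hsp := h (k + 1) (by omega) hpP
  have hback := apply_zero_of_iterate (τ := τ) (δ := δ) Z k
  rw [← hW] at hback
  have hneg : δ ^ (k + 1) * Z 0 < 0 := mul_neg_of_pos_of_neg (by positivity) hZ0
  -- `Z` is left of the vertical axis, so `W` is outside the image of the axis under `k + 1` steps;
  -- that line has intercepts `endHeight k + 1` and `endHeight (k + 1)`.
  have houter : T < k + 1 →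
      (endHeight τ δ k + 1) * endHeight τ δ (k + 1)
        < endHeight τ δ (k + 1) * W 0 + (endHeight τ δ k + 1) * W 1 := by
    intro hlt'
    have hsk := h k (by omega) (by omega)
    have hN := h.conv_pos hδ (n := k + 1) (by omega) (by omega)
    have e1 := h.endHeight_add_one (n := k) (by omega) (by omega)
    have e2 := h.endHeight_mul (n := k + 1) (by omega) hpP
    have e3 : lucasSeq τ δ k * lucasSeq τ δ (k + 1) *
        (endHeight τ δ (k + 1) * W 0 + (endHeight τ δ k + 1) * W 1
          - (endHeight τ δ k + 1) * endHeight τ δ (k + 1))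
        = lucasConv τ δ (k + 1) * -(δ ^ (k + 1) * Z 0) := by
      rw [hback]
      linear_combination (lucasSeq τ δ k * W 0 - lucasConv τ δ (k + 1)) * e2
        + (lucasSeq τ δ (k + 1) * W 1 - lucasSeq τ δ (k + 1) * endHeight τ δ (k + 1)) * e1
    have e4 : 0 < lucasSeq τ δ k * lucasSeq τ δ (k + 1) *
        (endHeight τ δ (k + 1) * W 0 + (endHeight τ δ k + 1) * W 1
          - (endHeight τ δ k + 1) * endHeight τ δ (k + 1)) := by
      rw [e3]; exact mul_pos hN (by linarith)
    have := pos_of_mul_pos_right e4 (by positivity)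
    linarith
  refine ⟨k + 1, hTp, hpP, hlt, hpos, hW1, ?_, ?_, ?_⟩
  · rcases hTp.eq_or_lt with heq | hlt'
    · rw [heq, side_endHeight (by omega) hsp.ne', ← heq]
      exact mul_nonpos_of_nonneg_of_nonpos (by positivity) hT
    · exact side_nonpos_of_intercepts (h.endHeight_nonneg hδ (by omega))
        (by have := h.endHeight_mono hδ hT1 (show T ≤ k by omega) (by omega); linarith)
        (h.endHeight_mono hδ hT1 hTp hpP) hpos.le hW1 (houter hlt').le
  · rcases hpP.eq_or_lt with heq | hlt'
    · rw [← heq, side_endHeight (by omega) hsp.ne', heq]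
      exact mul_nonneg (by positivity) hP
    · have hs2 := h (k + 1 + 1) (by omega) (by omega)
      have hN := h.conv_pos hδ (n := k + 1 + 1) (by omega) (by omega)
      have e1 := h.endHeight_add_one (n := k + 1) (by omega) (by omega)
      have e2 := h.endHeight_mul (n := k + 1 + 1) (by omega) (by omega)
      -- `Y` is the preimage of `Z`; it is on the right because `Z 1 ≤ 0`. Hence `W` is inside the
      -- image of the axis under one step more.
      set Y : Plane := !₂[-Z 1 / δ, Z 0 - 1 + τ * Z 1 / δ] with hY
      have hYZ : affStep τ δ Y = Z := by
        apply plane_ext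
        · simp [hY]; ring
        · simp [hY]; field_simp
      have hb2 := apply_zero_of_iterate (τ := τ) (δ := δ) Y (k + 1)
      rw [Function.iterate_succ_apply, hYZ, ← hW] at hb2
      have hY0 : 0 ≤ δ ^ (k + 1 + 1) * Y 0 := by
        have : 0 ≤ -Z 1 / δ := div_nonneg (by linarith) hδ.le
        simp [hY]
        positivity
      have hm1 := h.endHeight_mono hδ (show 1 ≤ k + 1 by omega) hpP le_rfl
      have hm2 := h.endHeight_mono hδ (show 1 ≤ k + 1 + 1 by omega) (show k + 1 + 1 ≤ P by omega)
        le_rfl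
      have hn1 := h.endHeight_nonneg hδ hpP
      have hn2 := h.endHeight_pos hδ (show 2 ≤ k + 1 + 1 by omega) (by omega)
      refine side_nonneg_of_intercepts (a := endHeight τ δ (k + 1) + 1)
        (b := endHeight τ δ (k + 1 + 1)) hn2 (by linarith) (by linarith) hm2 hpos.le hW1 ?_
      have e3 : lucasSeq τ δ (k + 1) * lucasSeq τ δ (k + 1 + 1) *
          ((endHeight τ δ (k + 1) + 1) * endHeight τ δ (k + 1 + 1) -
          (endHeight τ δ (k + 1 + 1) * W 0 + (endHeight τ δ (k + 1) + 1) * W 1))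
          = lucasConv τ δ (k + 1 + 1) * (δ ^ (k + 1 + 1) * Y 0) := by
        rw [hb2]
        linear_combination -(lucasSeq τ δ (k + 1) * W 0 - lucasConv τ δ (k + 1 + 1)) * e2
          - (lucasSeq τ δ (k + 1 + 1) * W 1
            - lucasSeq τ δ (k + 1 + 1) * endHeight τ δ (k + 1 + 1)) * e1
      have e4 : 0 ≤ lucasSeq τ δ (k + 1) * lucasSeq τ δ (k + 1 + 1) *
          ((endHeight τ δ (k + 1) + 1) * endHeight τ δ (k + 1 + 1) -
          (endHeight τ δ (k + 1 + 1) * W 0 + (endHeight τ δ (k + 1) + 1) * W 1)) := by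
        rw [e3]; positivity
      have := nonneg_of_mul_nonneg_right e4 (by positivity)
      linarith
  · intro hz
    have hk1 : 1 ≤ k := by
      by_contra hk
      have : k = 0 := by omega
      subst this
      rw [hW1e] at hz
      simp at hz
      rcases hz with hz | hz <;> linarith
    rcases hTp.eq_or_lt with heq | hlt'
    · have hT' : side (endHeight τ δ T) W ≤ 0 := by
        rw [heq, hW, side_endHeight (by omega) hsp.ne', ← heq]
        exact mul_nonpos_of_nonneg_of_nonpos (by positivity) hT
      have hyT := h.endHeight_pos hδ (show 2 ≤ T by omega) (by omega)
      simp only [side] at hT'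
      by_contra hc
      push Not at hc
      nlinarith
    · have h1 := houter hlt'
      have h2 := h.endHeight_pos hδ (show 2 ≤ k + 1 by omega) hpP
      have h3 := h.endHeight_mono hδ hT1 (show T ≤ k by omega) (by omega)
      rw [hz] at h1
      by_contra hc
      push Not at hc
      nlinarith
end

noncomputable section
namespace BCNF

variable (P : BCNF)

/-! ### Orbits of the normal form -/

theorem fL_eq_affStep : P.fL = affStep P.tauL P.deltaL := by
  funext Z
  apply plane_ext <;> simp [fL, act_apply, AL]

theorem fR_eq_affStep : P.fR = affStep P.tauR P.deltaR := by
  funext Z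
  apply plane_ext <;> simp [fR, act_apply, AR]

theorem f_of_nonpos {Z : Plane} (h : Z 0 ≤ 0) : P.f Z = affStep P.tauL P.deltaL Z := by
  rw [f, if_pos h, fL_eq_affStep]

theorem f_of_nonneg {Z : Plane} (h : 0 ≤ Z 0) : P.f Z = affStep P.tauR P.deltaR Z := by
  by_cases h0 : Z 0 ≤ 0
  · have : Z 0 = 0 := le_antisymm h0 h
    rw [f_of_nonpos P h0]
    apply plane_ext <;> simp [this]
  · rw [f, if_neg h0, fR_eq_affStep]

theorem f_iterate_of_nonpos {Z : Plane} {n : ℕ}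
    (h : ∀ i < n, (affStep P.tauL P.deltaL)^[i] Z 0 ≤ 0) :
    P.f^[n] Z = (affStep P.tauL P.deltaL)^[n] Z := by
  induction n with
  | zero => rfl
  | succ n ih =>
    rw [Function.iterate_succ_apply', Function.iterate_succ_apply',
      ih fun i hi => h i (by omega), f_of_nonpos P (h n (by omega))]

theorem f_iterate_of_nonneg {Z : Plane} {n : ℕ}
    (h : ∀ i < n, 0 ≤ (affStep P.tauR P.deltaR)^[i] Z 0) :
    P.f^[n] Z = (affStep P.tauR P.deltaR)^[n] Z := by
  induction n with
  | zero => rfl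
  | succ n ih =>
    rw [Function.iterate_succ_apply', Function.iterate_succ_apply',
      ih fun i hi => h i (by omega), f_of_nonneg P (h n (by omega))]

theorem AL_pow (i : ℕ) :
    (P.AL ^ i) 0 0 = lucasSeq P.tauL P.deltaL (i + 1) ∧
      (P.AL ^ i) 0 1 = lucasSeq P.tauL P.deltaL i := by
  induction i with
  | zero => simp [lucasSeq]
  | succ i ih =>
    rw [pow_succ]
    simp only [Matrix.mul_apply, Fin.sum_univ_two, ih.1, ih.2]
    simp [AL, lucasSeq]
    ring

theorem intercept_eq (i : ℕ) : P.intercept i = startHeight P.tauL P.deltaL i := by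
  rw [intercept, startHeight, (P.AL_pow i).2, fL_eq_affStep, affStep_iterate_zero]
  simp

/-- The slope `m_k` is `-s_{k+1} / s_k`, so negative slopes before `p*` keep the sequence positive.
-/
theorem lucasPos_of_le_pStar {p : ℕ} (hp : (p : ℕ∞) ≤ P.pStar) :
    LucasPos P.tauL P.deltaL p := by
  intro i hi1 hip
  induction i, hi1 using Nat.le_induction with
  | base => simp [lucasSeq]
  | succ k hk ih =>
    have h1 := ih (by omega)
    have hs : P.slope k < 0 := by
      by_contra hc
      push Not at hc
      have hlt : (k : ℕ∞) < P.pStar := lt_of_lt_of_le (by exact_mod_cast hip) hp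
      exact notMem_of_lt_csInf hlt (OrderBot.bddBelow _) ⟨k, hk, hc, rfl⟩
    rw [slope, (P.AL_pow k).1, (P.AL_pow k).2] at hs
    by_contra hc
    push Not at hc
    exact absurd hs (not_lt.2 (div_nonneg (by linarith) h1.le))

theorem startHeight_le {τ δ : ℝ} {p : ℕ} (h : LucasPos τ δ p) (hp : 1 ≤ p) :
    startHeight τ δ p ≤ -1 := by
  obtain ⟨k, rfl⟩ : ∃ k, p = k + 1 := ⟨p - 1, by omega⟩
  have hs := h (k + 1) (by omega) le_rfl
  rw [startHeight, neg_div, neg_le_neg_iff, one_le_div hs, lucasSum]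
  linarith [h.sum_nonneg (n := k) (by omega)]

/-- The orbit of the corner `(0, c_p)`. -/
structure CornerData (p q : ℕ) : Prop where
  exits : Exits P.tauR P.deltaR (endHeight P.tauL P.deltaL p) q
  cornerQ_eq : P.cornerQ p = q
  cornerF_eq : P.cornerF p = orb P.tauR P.deltaR (endHeight P.tauL P.deltaL p) (q + 1)
  cornerU_eq : P.cornerU p 1 = crossing P.tauR P.deltaR (endHeight P.tauL P.deltaL p) q

/-- The corner runs strictly on the left until it returns to the axis at step `p`, after which its
orbit is that of `(0, endHeight p)` under the right piece. The assumption on `f(P_p)` is what makes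
this second orbit leave the right half-plane. -/
theorem exists_cornerData {p : ℕ} (hp : 1 ≤ p) (h : LucasPos P.tauL P.deltaL p)
    (hpre : P.f (P.corner p) ∈ P.PhiPre) : ∃ q, P.CornerData p q := by
  have hδ := P.deltaL_pos
  set c := startHeight P.tauL P.deltaL p with hc
  set y := endHeight P.tauL P.deltaL p with hy
  have hy0 : 0 ≤ y := h.endHeight_nonneg hδ le_rfl
  have hcorner : P.corner p = !₂[0, c] := by rw [corner, intercept_eq]
  have horb : (affStep P.tauL P.deltaL)^[p] !₂[0, c] = !₂[0, y] :=
    orb_startHeight hp (h p hp le_rfl).ne'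
  have hneg : ∀ j, j < p → (affStep P.tauL P.deltaL)^[p - j] !₂[0, c] 0 ≤ 0 ∧
      (1 ≤ j → (affStep P.tauL P.deltaL)^[p - j] !₂[0, c] 0 < 0) := by
    intro j
    induction j with
    | zero => intro _; simp [horb]
    | succ j ih =>
      intro hj
      have h1 := (ih (by omega)).1
      rw [show p - j = p - (j + 1) + 1 by omega] at h1
      have := h.iterate_neg_of_succ hδ (by omega) (by simp) (Or.inr (by omega)) h1
      exact ⟨this.le, fun _ => this⟩
  have hneg' : ∀ i, 1 ≤ i → i < p → (affStep P.tauL P.deltaL)^[i] !₂[0, c] 0 < 0 := by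
    intro i h1 h2
    have := (hneg (p - i) (by omega)).2 (by omega)
    rwa [show p - (p - i) = i by omega] at this
  have hle : ∀ i ≤ p, (affStep P.tauL P.deltaL)^[i] !₂[0, c] 0 ≤ 0 := by
    intro i hi
    rcases i with _ | i
    · simp
    · rcases hi.eq_or_lt with heq | hlt
      · rw [heq, horb]; simp
      · exact (hneg' _ (by omega) hlt).le
  have hfL : ∀ i ≤ p, P.f^[i] !₂[0, c] = (affStep P.tauL P.deltaL)^[i] !₂[0, c] := fun i hi =>
    P.f_iterate_of_nonpos fun k hk => hle k (by omega)
  have hfR : ∀ j, (∀ i < j, 0 ≤ orb P.tauR P.deltaR y i 0) →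
      P.f^[j + p] !₂[0, c] = orb P.tauR P.deltaR y j := by
    intro j hj
    rw [Function.iterate_add_apply, hfL p le_rfl, horb]
    exact P.f_iterate_of_nonneg hj
  have hexit : ∃ j, orb P.tauR P.deltaR y j 0 < 0 := by
    by_contra hcon
    push Not at hcon
    obtain ⟨n, hn1, hn⟩ := hpre
    rw [hcorner, ← Function.iterate_succ_apply] at hn
    -- A return during the left passage is impossible: the preceding iterate is strictly left, which
    -- makes the ordinate positive. Later iterates are on the right by assumption.
    by_cases hnp : n + 1 ≤ p
    · obtain ⟨k, rfl⟩ : ∃ k, n = k + 1 := ⟨n - 1, by omega⟩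
      rw [Nat.succ_eq_add_one, hfL _ hnp] at hn
      have h2 := hn.2
      rw [affStep_iterate_succ_one] at h2
      have := hneg' (k + 1) (by omega) (by omega)
      nlinarith
    · have h2 := hn.1
      rw [Nat.succ_eq_add_one, show n + 1 = (n + 1 - p) + p by omega,
        hfR _ fun i _ => hcon i] at h2
      exact absurd (hcon _) (not_le.2 h2)
  classical
  obtain ⟨q, hq⟩ : ∃ q, Exits P.tauR P.deltaR y q := by
    have hex : ∃ j, orb P.tauR P.deltaR y (j + 1) 0 < 0 := by
      obtain ⟨j, hj⟩ := hexit
      rcases j with _ | j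
      · simp at hj
      · exact ⟨j, hj⟩
    refine ⟨Nat.find hex, hy0, ?_, Nat.find_spec hex⟩
    intro i hi
    rcases i with _ | i
    · simp
    · exact not_lt.1 (Nat.find_min hex (show i < Nat.find hex by omega))
  -- The closed left half-plane contains the axis, so the landing at step `p` is not an exit; the
  -- exit is one step later, at `(y + 1, 0)`.
  have hchiL : P.chiL (P.corner p) = p + 1 := by
    have hmem : 1 ≤ p + 1 ∧ P.f^[p + 1] (P.corner p) ∉ halfL := by
      refine ⟨by omega, ?_⟩
      rw [hcorner, add_comm, hfR 1 (by simp)]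
      simp [halfL]
      linarith
    refine le_antisymm (Nat.sInf_le hmem) (le_csInf ⟨_, hmem⟩ ?_)
    rintro i ⟨-, hi⟩
    by_contra hcon
    apply hi
    rw [hcorner, hfL i (by omega)]
    exact hle i (by omega)
  have hexitpt : P.cornerExit p = orb P.tauR P.deltaR y 1 := by
    rw [cornerExit, hchiL, fL_eq_affStep, hcorner, Function.iterate_succ_apply', horb]
    apply plane_ext <;> simp
  have hiter : ∀ j ≤ q, P.f^[j] (orb P.tauR P.deltaR y 1) = orb P.tauR P.deltaR y (j + 1) := by
    intro j hj
    rw [P.f_iterate_of_nonneg, ← orb_add]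
    intro i hi
    rw [← orb_add]
    exact hq.stay _ (by omega)
  have hQ : P.cornerQ p = q := by
    have hmem : 1 ≤ q ∧ P.f^[q] (P.cornerExit p) ∉ halfR := by
      refine ⟨hq.one_le, ?_⟩
      rw [hexitpt, hiter q le_rfl]
      exact not_le.2 hq.leave
    refine le_antisymm (Nat.sInf_le hmem) (le_csInf ⟨_, hmem⟩ ?_)
    rintro i ⟨-, hi⟩
    by_contra hcon
    apply hi
    rw [hexitpt, hiter i (by omega)]
    exact hq.stay _ (by omega)
  have hF : P.cornerF p = orb P.tauR P.deltaR y (q + 1) := by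
    rw [cornerF, hQ, hexitpt, fR_eq_affStep, ← orb_add]
  have hinv : P.fInv (P.cornerF p) = orb P.tauR P.deltaR y q := by
    rw [hF, orb_succ, ← P.f_of_nonneg (hq.stay q le_rfl)]
    exact Function.leftInverse_invFun P.f_injective _
  refine ⟨q, hq, hQ, hF, ?_⟩
  have hne : orb P.tauR P.deltaR y q 0 - orb P.tauR P.deltaR y (q + 1) 0 ≠ 0 := by
    have := hq.last_lt
    linarith
  rw [cornerU, hinv, hF, ← hy]
  simp only [lineMeetsSwitching, crossing, pivot]
  simp
  field_simp
  ring

theorem mem_Omega_iff {pmin pmax : ℕ} (h1 : LucasPos P.tauL P.deltaL pmax) (h0 : 1 ≤ pmin)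
    (h2 : pmin ≤ pmax) (Z : Plane) :
    Z ∈ P.Omega pmin pmax ↔ Z ∈ Phi ∧ 0 ≤ side (startHeight P.tauL P.deltaL pmax) Z ∧
      side (startHeight P.tauL P.deltaL pmin) Z ≤ 0 := by
  have e : ∀ {c : ℝ}, c ≤ -1 → (c + 1) / c * (c - Z 1) - Z 0 = side c Z / c := by
    intro c hc
    have : c ≠ 0 := by linarith
    rw [side]
    field_simp
    ring
  have a1 := startHeight_le h1 (by omega)
  have a2 := startHeight_le (p := pmin) (fun i hi hi' => h1 i hi (by omega)) h0
  simp only [Omega, Set.mem_ofPred_eq, intercept_eq]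
  refine and_congr_right fun _ => and_congr ?_ ?_
  · rw [← sub_nonpos, e a1]
    constructor
    · intro h; by_contra hc; push Not at hc
      exact absurd h (not_le.2 (div_pos_of_neg_of_neg hc (by linarith)))
    · intro h; exact div_nonpos_of_nonneg_of_nonpos h (by linarith)
  · rw [← sub_nonneg, e a2]
    constructor
    · intro h; by_contra hc; push Not at hc
      exact absurd h (not_le.2 (div_neg_of_pos_of_neg hc (by linarith)))
    · intro h; exact div_nonneg_of_nonpos h (by linarith)

/-- The dynamics on `Ω`: a point of `Ω` spends `p` steps on the left and `q` steps on the right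
before it returns to `Ω`. -/
structure Excursion (pmin pmax : ℕ) (Z : Plane) (p q : ℕ) : Prop where
  mem_Gam : (p, q) ∈ P.Gam pmin pmax
  pos_left : 1 ≤ p
  pos_right : 1 ≤ q
  left : ∀ i < p, P.f^[i] Z 0 ≤ 0
  right : ∀ i, p ≤ i → i < p + q → 0 ≤ P.f^[i] Z 0
  returnTime_eq : P.returnTime Z = p + q
  F_mem : P.F Z ∈ P.Omega pmin pmax

variable {P}

theorem OutputsChaos.pmin_lt {pmin pmax : ℕ} (h : P.OutputsChaos pmin pmax) :
    1 ≤ pmin ∧ pmin < pmax := by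
  have h1 := h.step1.1
  have h2 := h.step2.1
  simp only [Set.mem_ofPred_eq] at h1 h2
  omega

theorem OutputsChaos.lucasPos {pmin pmax : ℕ} (h : P.OutputsChaos pmin pmax) :
    LucasPos P.tauL P.deltaL pmax :=
  P.lucasPos_of_le_pStar (h.step1.1.2.1.trans (min_le_left _ _))

/-- Here (S) and (T) become geometry: `U` and `V` are the crossings of the corner orbits, and the
inequalities on `F_p` are signs of `side`. The corner `p_min` gives the inner orbit and `p_max` the
outer one, as `endHeight` increases. -/
theorem OutputsChaos.barrier {pmin pmax : ℕ} (h : P.OutputsChaos pmin pmax) :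
    Barrier P.tauR P.deltaR (endHeight P.tauL P.deltaL pmin) (endHeight P.tauL P.deltaL pmax)
      (P.cornerQ pmin) (P.cornerQ pmax) (startHeight P.tauL P.deltaL pmin)
      (startHeight P.tauL P.deltaL pmax) := by
  obtain ⟨h0, hlt⟩ := h.pmin_lt
  have hpos := h.lucasPos
  have hpos' : LucasPos P.tauL P.deltaL pmin := fun i hi hi' => hpos i hi (by omega)
  obtain ⟨s1, s2, s3⟩ := h.step1.1.2.2
  obtain ⟨t1, t2, t3⟩ := h.step2.1.2.2
  obtain ⟨qS, hS⟩ := P.exists_cornerData (by omega) hpos s1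
  obtain ⟨qT, hT⟩ := P.exists_cornerData (by omega) hpos' t1
  have hcor : ∀ p, P.corner p 1 = startHeight P.tauL P.deltaL p ∧ P.corner p 0 = 0 := by
    intro p; rw [corner, intercept_eq]; simp
  have hf : ∀ p, P.f (P.corner p) 0 = startHeight P.tauL P.deltaL p + 1 := by
    intro p
    rw [P.f_of_nonpos (hcor p).2.le, affStep_zero, (hcor p).1, (hcor p).2]; ring
  rw [hS.cornerU_eq, (hcor _).1] at s2
  rw [hT.cornerU_eq, (hcor _).1] at t2
  rw [hf, (hcor _).1, hS.cornerF_eq] at s3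
  rw [hf, (hcor _).1, hT.cornerF_eq] at t3
  rw [hS.cornerQ_eq, hT.cornerQ_eq]
  exact ⟨hT.exits, hS.exits, hpos.endHeight_mono P.deltaL_pos h0 hlt.le le_rfl,
    startHeight_le hpos (by omega), startHeight_le hpos' h0, t2, s2,
    by simp only [side]; linarith, by simp only [side]; linarith⟩

/-- The left passage ends between two lines with nonnegative parameters, where the point lies on a
segment of an intermediate orbit; the barrier then returns it between the lines that bound `Ω`. -/
theorem OutputsChaos.exists_excursion {pmin pmax : ℕ} (h : P.OutputsChaos pmin pmax) {Z : Plane}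
    (hZ : Z ∈ P.Omega pmin pmax) : ∃ p q, P.Excursion pmin pmax Z p q := by
  obtain ⟨h0, hlt⟩ := h.pmin_lt
  have hpos := h.lucasPos
  have hδ := P.deltaL_pos
  have hB := h.barrier
  obtain ⟨⟨hZ0, hZ1⟩, hS, hT⟩ := (P.mem_Omega_iff hpos h0 hlt.le Z).1 hZ
  obtain ⟨p, hTp, hpP, hleft, hcross, hW1, hWT, hWS, hWax⟩ :=
    hpos.exists_first_crossing hδ h0 hlt hZ0 hZ1 hT hS
  set W := (affStep P.tauL P.deltaL)^[p] Z with hW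
  obtain ⟨s, r, hs1, hs2, hr0, hr1, hmix⟩ := exists_mix_eq (τ := P.tauR) (δ := P.deltaR)
    hB.inner.nonneg hB.le hcross.le hW1 hWT hWS
    (fun hz => ⟨hWax hz, hpos.endHeight_pos hδ (by omega) le_rfl⟩)
  obtain ⟨n, hn1, hn2, hn3, hright, hexit, hnS, hnT⟩ :=
    hB.exists_exit P.deltaR_pos hs1 hs2 hr0 hr1
  rw [← hmix] at hright hexit hnS hnT
  have hfL : ∀ i ≤ p, P.f^[i] Z = (affStep P.tauL P.deltaL)^[i] Z := fun i hi =>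
    P.f_iterate_of_nonpos fun k hk => hleft k (by omega)
  have hfR : ∀ j ≤ n, P.f^[p + j] Z = (affStep P.tauR P.deltaR)^[j] W := by
    intro j hj
    rw [add_comm, Function.iterate_add_apply, hfL p le_rfl, ← hW]
    exact P.f_iterate_of_nonneg fun i hi => hright i (by omega)
  have hr' : ∀ i, p ≤ i → i < p + n → 0 ≤ P.f^[i] Z 0 := by
    intro i hi hi'
    obtain ⟨j, rfl⟩ := Nat.exists_eq_add_of_le hi
    rw [hfR j (by omega)]
    exact hright j (by omega)
  have hend : P.f^[p + n] Z ∈ Phi := by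
    refine ⟨by rw [hfR n le_rfl]; exact hexit, ?_⟩
    obtain ⟨m, rfl⟩ : ∃ m, n = m + 1 := ⟨n - 1, by omega⟩
    rw [hfR _ le_rfl, affStep_iterate_succ_one]
    have := mul_nonneg P.deltaR_pos.le (hright m (by omega))
    linarith
  have hret : P.returnTime Z = p + n := by
    have hmem : 1 ≤ p + n ∧ P.f^[p + n] Z ∈ Phi := ⟨by omega, hend⟩
    refine le_antisymm (Nat.sInf_le hmem) (le_csInf ⟨_, hmem⟩ ?_)
    -- No earlier iterate is in `Phi`: left iterates after the start have positive ordinate, and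
    -- right iterates have nonnegative abscissa.
    rintro i ⟨hi1, hi⟩
    by_contra hcon
    push Not at hcon
    by_cases hip : p ≤ i
    · exact absurd hi.1 (not_lt.2 (hr' i hip hcon))
    · obtain ⟨k, rfl⟩ : ∃ k, i = k + 1 := ⟨i - 1, by omega⟩
      have h2 := hi.2
      rw [hfL _ (by omega), affStep_iterate_succ_one] at h2
      have := hpos.iterate_neg_of_succ hδ (m := k) (by omega) hZ0.le (Or.inl hZ0)
        (hleft (k + 1) (by omega))
      nlinarith
  have hqle := hB.inner.le_of_le P.deltaR_pos hB.outer hB.le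
  refine ⟨p, n, ⟨hTp, hpP, ?_, ?_⟩, by omega, hn1, ?_, hr', hret, ?_⟩
  · exact (min_le_left _ _).trans hn2
  · exact hn3.trans (Nat.add_le_add_right (le_max_right _ _) 1)
  · intro i hi
    rw [hfL i hi.le]
    exact hleft i hi
  · rw [F, hret]
    refine (P.mem_Omega_iff hpos h0 hlt.le _).2 ⟨hend, ?_, ?_⟩
    · rw [hfR n le_rfl]; exact hnS
    · rw [hfR n le_rfl]; exact hnT

end BCNF
end

noncomputable section

/-! ### Angles and quadratic forms -/

@[simp] theorem unitVec_zero (θ : ℝ) : unitVec θ 0 = Real.cos θ := by simp [unitVec]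

@[simp] theorem unitVec_one (θ : ℝ) : unitVec θ 1 = Real.sin θ := by simp [unitVec]

theorem act_smul (M : Matrix (Fin 2) (Fin 2) ℝ) (r : ℝ) (v : Plane) :
    act M (r • v) = r • act M v := by
  simp [act]

theorem act_mul (M N : Matrix (Fin 2) (Fin 2) ℝ) (v : Plane) :
    act (M * N) v = act M (act N v) := by
  apply plane_ext <;>
  · simp only [act_apply, Matrix.mul_apply, Fin.sum_univ_two]
    ring

theorem norm_sq_plane (v : Plane) : ‖v‖ ^ 2 = v 0 ^ 2 + v 1 ^ 2 := by
  rw [EuclideanSpace.norm_sq_eq]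
  simp [Fin.sum_univ_two]

theorem norm_unitVec (θ : ℝ) : ‖unitVec θ‖ = 1 := by
  have := norm_sq_plane (unitVec θ)
  simp only [unitVec_zero, unitVec_one, Real.cos_sq_add_sin_sq] at this
  exact (sq_eq_sq₀ (norm_nonneg _) zero_le_one).1 (by rw [this, one_pow])

theorem unitVec_add_int_mul_pi (θ : ℝ) (n : ℤ) :
    unitVec (θ + n * Real.pi) = ((-1 : ℝ) ^ n) • unitVec θ := by
  apply plane_ext
  · simp [Real.cos_add_int_mul_pi]
  · simp [Real.sin_add_int_mul_pi]

theorem eq_smul_unitVec_arg {w : Plane} (hw : w ≠ 0) :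
    ∃ r : ℝ, r ≠ 0 ∧ w = r • unitVec (Complex.arg ⟨w 0, w 1⟩) := by
  set z : ℂ := ⟨w 0, w 1⟩ with hz
  have hz0 : z ≠ 0 := by
    intro h
    apply hw
    have h0 := congrArg Complex.re h
    have h1 := congrArg Complex.im h
    exact plane_ext h0 h1
  have hn : ‖z‖ ≠ 0 := norm_ne_zero_iff.2 hz0
  refine ⟨‖z‖, hn, ?_⟩
  apply plane_ext
  · simp [Complex.cos_arg hz0]
    field_simp
    simp [hz]
  · simp [Complex.sin_arg]
    field_simp
    simp [hz]

theorem exists_angle {w : Plane} (hw : w ≠ 0) :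
    ∃ θ ∈ Set.Ico 0 Real.pi, ∃ r : ℝ, r ≠ 0 ∧ w = r • unitVec θ := by
  obtain ⟨r, hr, e⟩ := eq_smul_unitVec_arg hw
  set ψ := Complex.arg ⟨w 0, w 1⟩
  refine ⟨toIcoMod Real.pi_pos 0 ψ, toIcoMod_mem_Ico' Real.pi_pos ψ,
    r * (-1) ^ (toIcoDiv Real.pi_pos 0 ψ), mul_ne_zero hr (zpow_ne_zero _ (by norm_num)), ?_⟩
  rw [mul_smul, ← unitVec_add_int_mul_pi, e]
  congr 2
  have := self_sub_toIcoDiv_zsmul Real.pi_pos 0 ψ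
  rw [← this, zsmul_eq_mul]
  ring

theorem lineAngle_smul_unitVec {r : ℝ} (hr : r ≠ 0) (φ : ℝ) :
    lineAngle (r • unitVec φ) = toIcoMod Real.pi_pos 0 φ := by
  have hw : r • unitVec φ ≠ 0 := by
    refine smul_ne_zero hr fun h => ?_
    have := norm_unitVec φ
    rw [h, norm_zero] at this
    exact zero_ne_one this
  obtain ⟨a, ha, e⟩ := eq_smul_unitVec_arg hw
  rw [lineAngle]
  set ψ := Complex.arg ⟨(r • unitVec φ) 0, (r • unitVec φ) 1⟩
  have e0 := congrArg (fun v : Plane => v 0) e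
  have e1 := congrArg (fun v : Plane => v 1) e
  simp at e0 e1
  have hs : Real.sin (ψ - φ) = 0 := by
    have : a * Real.sin (ψ - φ) = 0 := by
      rw [Real.sin_sub]
      linear_combination Real.sin φ * e0 - Real.cos φ * e1
    exact (mul_eq_zero.1 this).resolve_left ha
  obtain ⟨n, hn⟩ := Real.sin_eq_zero_iff.1 hs
  rw [show ψ = φ + n • Real.pi by rw [zsmul_eq_mul]; linarith, toIcoMod_add_zsmul]

/-- The determinant of `unitVec θ` and `v`. -/
def detAngle (θ : ℝ) (v : Plane) : ℝ := Real.cos θ * v 1 - Real.sin θ * v 0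

theorem detAngle_unitVec (θ φ : ℝ) : detAngle θ (unitVec φ) = Real.sin (φ - θ) := by
  simp only [detAngle, unitVec_zero, unitVec_one, Real.sin_sub]
  ring

theorem detAngle_smul (θ r : ℝ) (v : Plane) : detAngle θ (r • v) = r * detAngle θ v := by
  simp [detAngle]; ring

theorem detAngle_add (θ : ℝ) (v w : Plane) : detAngle θ (v + w) = detAngle θ v + detAngle θ w := by
  simp [detAngle]; ring

/-- A quadratic form that is nonnegative exactly on the lines with angle in
`circIcc θ₀ θ₁`. -/
def arcForm (θ₀ θ₁ : ℝ) (v : Plane) : ℝ :=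
  (if θ₀ ≤ θ₁ then -1 else 1) * (detAngle θ₀ v * detAngle θ₁ v)

theorem arcForm_smul (θ₀ θ₁ r : ℝ) (v : Plane) :
    arcForm θ₀ θ₁ (r • v) = r ^ 2 * arcForm θ₀ θ₁ v := by
  simp only [arcForm, detAngle_smul]
  ring

theorem continuous_arcForm (θ₀ θ₁ : ℝ) : Continuous (arcForm θ₀ θ₁) := by
  unfold arcForm detAngle
  fun_prop

theorem sin_sub_pos {a θ : ℝ} (ha : a ∈ Set.Ico 0 Real.pi) (hθ : θ ∈ Set.Ico 0 Real.pi)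
    (h : a < θ) : 0 < Real.sin (θ - a) :=
  Real.sin_pos_of_pos_of_lt_pi (by linarith) (by linarith [ha.1, hθ.2])

theorem sin_sub_neg {a θ : ℝ} (ha : a ∈ Set.Ico 0 Real.pi) (hθ : θ ∈ Set.Ico 0 Real.pi)
    (h : θ < a) : Real.sin (θ - a) < 0 := by
  have := sin_sub_pos hθ ha h
  rw [← neg_sub, Real.sin_neg]
  linarith

theorem mem_circIcc_iff {θ₀ θ₁ θ : ℝ} (h0 : θ₀ ∈ Set.Ico 0 Real.pi) (h1 : θ₁ ∈ Set.Ico 0 Real.pi)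
    (h : θ ∈ Set.Ico 0 Real.pi) : θ ∈ circIcc θ₀ θ₁ ↔ 0 ≤ arcForm θ₀ θ₁ (unitVec θ) := by
  simp only [circIcc, Set.mem_ofPred_eq, h, true_and, arcForm, detAngle_unitVec]
  by_cases hle : θ₀ ≤ θ₁
  · simp only [hle, not_lt.2 hle, true_and, false_and, or_false, if_true]
    rcases lt_trichotomy θ θ₀ with hlt | rfl | hgt
    · have a := sin_sub_neg h0 h hlt
      have b := sin_sub_neg h1 h (lt_of_lt_of_le hlt hle)
      constructor
      · rintro ⟨c, -⟩; linarith
      · intro c; nlinarith [mul_pos_of_neg_of_neg a b]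
    · simp [hle]
    · rcases lt_trichotomy θ θ₁ with hlt' | rfl | hgt'
      · have a := sin_sub_pos h0 h hgt
        have b := sin_sub_neg h1 h hlt'
        simp only [hgt.le, hlt'.le, true_and, true_iff]
        nlinarith [mul_neg_of_pos_of_neg a b]
      · simp [hle]
      · have a := sin_sub_pos h0 h hgt
        have b := sin_sub_pos h1 h hgt'
        constructor
        · rintro ⟨-, c⟩; linarith
        · intro c; nlinarith [mul_pos a b]
  · simp only [hle, not_le.1 hle, true_and, false_and, false_or, if_false, one_mul]
    push Not at hle
    rcases lt_trichotomy θ θ₁ with hlt | rfl | hgt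
    · have a := sin_sub_neg h1 h hlt
      have b := sin_sub_neg h0 h (hlt.trans hle)
      simp only [hlt.le, true_or, true_iff]
      exact (mul_pos_of_neg_of_neg b a).le
    · simp
    · rcases lt_trichotomy θ θ₀ with hlt' | rfl | hgt'
      · have a := sin_sub_pos h1 h hgt
        have b := sin_sub_neg h0 h hlt'
        constructor
        · rintro (c | c) <;> linarith
        · intro c; nlinarith [mul_neg_of_pos_of_neg a b]
      · simp
      · have a := sin_sub_pos h1 h hgt
        have b := sin_sub_pos h0 h hgt'
        simp only [hgt'.le, or_true, true_iff]
        exact (mul_pos b a).le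

/-! ### Fixed directions -/

theorem exists_eigenvector {M : Matrix (Fin 2) (Fin 2) ℝ} {l : ℝ}
    (h : l ^ 2 - M.trace * l + M.det = 0) :
    ∃ θ ∈ Set.Ico 0 Real.pi, act M (unitVec θ) = l • unitVec θ := by
  rw [Matrix.trace_fin_two, Matrix.det_fin_two] at h
  obtain ⟨v, hv0, hv⟩ : ∃ v : Plane, v ≠ 0 ∧ act M v = l • v := by
    -- A kernel vector of `M - l` is read off the first row, or off the second if the first
    -- vanishes; if both vanish, any vector serves.
    by_cases h1 : M 0 1 = 0 ∧ l = M 0 0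
    · by_cases h2 : M 1 0 = 0 ∧ l = M 1 1
      · refine ⟨!₂[1, 0], fun hc => ?_, ?_⟩
        · simpa using congrArg (fun v : Plane => v 0) hc
        · apply plane_ext <;> simp [act_apply, h1.2, h2.1]
      · refine ⟨!₂[l - M 1 1, M 1 0], fun hc => h2 ⟨?_, ?_⟩, ?_⟩
        · simpa using congrArg (fun v : Plane => v 1) hc
        · have := congrArg (fun v : Plane => v 0) hc
          simp at this
          linarith
        · apply plane_ext
          · simp [act_apply, h1.1, h1.2]
          · simp [act_apply]; ring
    · refine ⟨!₂[M 0 1, l - M 0 0], fun hc => h1 ⟨?_, ?_⟩, ?_⟩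
      · simpa using congrArg (fun v : Plane => v 0) hc
      · have := congrArg (fun v : Plane => v 1) hc
        simp at this
        linarith
      · apply plane_ext
        · simp [act_apply]; ring
        · simp [act_apply]; linarith
  obtain ⟨θ, hθ, r, hr, e⟩ := exists_angle hv0
  refine ⟨θ, hθ, ?_⟩
  rw [e, act_smul, smul_comm] at hv
  exact smul_right_injective Plane hr hv

theorem angleMap_of_eigenvector {M : Matrix (Fin 2) (Fin 2) ℝ} {l θ : ℝ} (hl : l ≠ 0)
    (hθ : θ ∈ Set.Ico 0 Real.pi) (h : act M (unitVec θ) = l • unitVec θ) : angleMap M θ = θ := by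
  rw [angleMap, h, lineAngle_smul_unitVec hl]
  exact (toIcoMod_eq_self Real.pi_pos).2 (by simpa using hθ)

/-- In the orthonormal frame turned by `θ`, the image of `unitVec t` has coordinates `a t` and `b
t`, and `θ + arctan (b / a)` is a local lift. At `θ` its derivative is `b' / a`, where `b'` is the
other diagonal entry of `M` in this frame, that is, the trace minus `l`. -/
theorem hasAngleDeriv_of_eigenvector {M : Matrix (Fin 2) (Fin 2) ℝ} {l θ : ℝ} (hl : l ≠ 0)
    (h : act M (unitVec θ) = l • unitVec θ) : HasAngleDeriv M ((M.trace - l) / l) θ := by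
  set a : ℝ → ℝ := fun t => Real.cos θ * act M (unitVec t) 0 + Real.sin θ * act M (unitVec t) 1
    with ha
  set b : ℝ → ℝ := fun t => Real.cos θ * act M (unitVec t) 1 - Real.sin θ * act M (unitVec t) 0
    with hb
  have h0 := congrArg (fun v : Plane => v 0) h
  have h1 := congrArg (fun v : Plane => v 1) h
  simp at h0 h1
  have haθ : a θ = l := by
    simp only [ha, h0, h1]
    linear_combination l * Real.cos_sq_add_sin_sq θ
  have hbθ : b θ = 0 := by
    simp only [hb, h0, h1]
    ring
  have hda : HasDerivAt a (Real.cos θ * (M 0 0 * -Real.sin θ + M 0 1 * Real.cos θ)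
      + Real.sin θ * (M 1 0 * -Real.sin θ + M 1 1 * Real.cos θ)) θ := by
    simp only [ha, act_apply, unitVec_zero, unitVec_one]
    exact ((((Real.hasDerivAt_cos θ).const_mul _).add
      ((Real.hasDerivAt_sin θ).const_mul _)).const_mul _).add
      ((((Real.hasDerivAt_cos θ).const_mul _).add
      ((Real.hasDerivAt_sin θ).const_mul _)).const_mul _)
  have hdb : HasDerivAt b (Real.cos θ * (M 1 0 * -Real.sin θ + M 1 1 * Real.cos θ)
      - Real.sin θ * (M 0 0 * -Real.sin θ + M 0 1 * Real.cos θ)) θ := by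
    simp only [hb, act_apply, unitVec_zero, unitVec_one]
    exact ((((Real.hasDerivAt_cos θ).const_mul _).add
      ((Real.hasDerivAt_sin θ).const_mul _)).const_mul _).sub
      ((((Real.hasDerivAt_cos θ).const_mul _).add
      ((Real.hasDerivAt_sin θ).const_mul _)).const_mul _)
  refine ⟨fun t => θ + Real.arctan (b t / a t), ?_, ?_⟩
  · have hne : ∀ᶠ t in 𝓝 θ, a t ≠ 0 := hda.continuousAt.eventually_ne (by rw [haθ]; exact hl)
    filter_upwards [hne] with t ht
    set φ := Real.arctan (b t / a t) with hφ
    have hcos : 0 < Real.cos φ := Real.cos_arctan_pos _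
    have htan : Real.sin φ = b t / a t * Real.cos φ := by
      rw [← Real.tan_mul_cos hcos.ne', hφ, Real.tan_arctan]
    have e : act M (unitVec t) = (a t / Real.cos φ) • unitVec (θ + φ) := by
      apply plane_ext
      · simp only [PiLp.smul_apply, unitVec_zero, Real.cos_add, htan, smul_eq_mul]
        field_simp
        simp only [ha, hb]
        linear_combination (-act M (unitVec t) 0) * Real.cos_sq_add_sin_sq θ
      · simp only [PiLp.smul_apply, unitVec_one, Real.sin_add, htan, smul_eq_mul]
        field_simp
        simp only [ha, hb]
        linear_combination (-act M (unitVec t) 1) * Real.cos_sq_add_sin_sq θ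
    rw [angleMap, e, lineAngle_smul_unitVec (div_ne_zero ht hcos.ne')]
  · have hq := (hdb.div hda (by rw [haθ]; exact hl)).arctan.const_add θ
    refine HasDerivAt.congr_deriv (f := fun t => θ + Real.arctan (b t / a t)) hq (Eq.symm ?_)
    simp only [Pi.div_apply, haθ, hbθ, zero_div, zero_mul, sub_zero]
    rw [Matrix.trace_fin_two]
    simp only [act_apply, unitVec_zero, unitVec_one] at h0 h1
    field_simp
    linear_combination (Real.cos θ) * h0 + Real.sin θ * h1
      + (M 0 0 + M 1 1 - l) * (- Real.cos_sq_add_sin_sq θ)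

/-- A matrix with positive determinant and distinct real eigenvalues has a stable and an unstable
direction. -/
theorem exists_stable_unstable {M : Matrix (Fin 2) (Fin 2) ℝ} (hdet : 0 < M.det)
    (hdisc : M.det < 1 / 4 * M.trace ^ 2) :
    ∃ s u l m : ℝ, IsStableAngle M s ∧ IsUnstableAngle M u ∧ l ≠ 0 ∧ 0 < m / l ∧ m / l < 1 ∧
      act M (unitVec s) = l • unitVec s ∧ act M (unitVec u) = m • unitVec u := by
  -- `l` is the eigenvalue of larger modulus, found by giving the square root the sign of the trace;
  -- both eigenvalues have the same sign.
  obtain ⟨l, m, hsum, hprod, hlm⟩ : ∃ l m : ℝ, l + m = M.trace ∧ l * m = M.det ∧ l * m < l ^ 2 := by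
    set r := Real.sqrt (1 / 4 * M.trace ^ 2 - M.det) with hr
    have hr2 : r ^ 2 = 1 / 4 * M.trace ^ 2 - M.det := Real.sq_sqrt (by linarith)
    have hr0 : 0 < r := Real.sqrt_pos.2 (by linarith)
    rcases le_total 0 M.trace with ht | ht
    · refine ⟨M.trace / 2 + r, M.trace / 2 - r, by ring, ?_, ?_⟩
      · linear_combination -hr2
      · nlinarith [mul_nonneg ht hr0.le]
    · refine ⟨M.trace / 2 - r, M.trace / 2 + r, by ring, ?_, ?_⟩
      · linear_combination -hr2
      · nlinarith [mul_nonneg (neg_nonneg.2 ht) hr0.le]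
  have hlmpos : 0 < l * m := by rw [hprod]; exact hdet
  have hl : l ≠ 0 := by rintro rfl; simp at hlmpos
  have hm : m ≠ 0 := by rintro rfl; simp at hlmpos
  have hl2 : 0 < l ^ 2 := by positivity
  have hratio : m / l = l * m / l ^ 2 := by field_simp
  have hpos : 0 < m / l := by rw [hratio]; exact div_pos hlmpos hl2
  have hlt : m / l < 1 := by rw [hratio, div_lt_one hl2]; exact hlm
  obtain ⟨s, hs, es⟩ := exists_eigenvector (M := M) (l := l) (by rw [← hsum, ← hprod]; ring)
  obtain ⟨u, hu, eu⟩ := exists_eigenvector (M := M) (l := m) (by rw [← hsum, ← hprod]; ring)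
  refine ⟨s, u, l, m, ⟨hs, angleMap_of_eigenvector hl hs es, m / l, hpos, hlt, ?_⟩,
    ⟨hu, angleMap_of_eigenvector hm hu eu, l / m, ?_, ?_⟩, hl, hpos, hlt, es, eu⟩
  · have := hasAngleDeriv_of_eigenvector hl es
    rwa [← hsum, add_sub_cancel_left] at this
  · have := (one_lt_inv₀ hpos).2 hlt
    rwa [inv_div] at this
  · have := hasAngleDeriv_of_eigenvector hm eu
    rwa [← hsum, add_sub_cancel_right] at this

theorem eq_combination {s u : ℝ} (h : Real.sin (u - s) ≠ 0) (v : Plane) :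
    v = (-detAngle u v / Real.sin (u - s)) • unitVec s
      + (detAngle s v / Real.sin (u - s)) • unitVec u := by
  apply plane_ext
  · simp [detAngle]
    field_simp
    rw [Real.sin_sub]
    ring
  · simp [detAngle]
    field_simp
    rw [Real.sin_sub]
    ring

/-- An arc that contains the stable direction of a matrix and not the unstable one is
invariant. -/
theorem arcForm_act_nonneg {M : Matrix (Fin 2) (Fin 2) ℝ} {s u l m θ₀ θ₁ : ℝ} (hl : l ≠ 0)
    (hpos : 0 < m / l) (hlt : m / l < 1) (es : act M (unitVec s) = l • unitVec s)
    (eu : act M (unitVec u) = m • unitVec u) (hs : 0 ≤ arcForm θ₀ θ₁ (unitVec s))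
    (hu : arcForm θ₀ θ₁ (unitVec u) < 0) {v : Plane} (hv : 0 ≤ arcForm θ₀ θ₁ v) :
    0 ≤ arcForm θ₀ θ₁ (act M v) := by
  have hsin : Real.sin (u - s) ≠ 0 := by
    intro h0
    obtain ⟨n, hn⟩ := Real.sin_eq_zero_iff.1 h0
    rw [show u = s + n * Real.pi by linarith, unitVec_add_int_mul_pi, arcForm_smul] at hu
    exact absurd hu (not_lt.2 (mul_nonneg (sq_nonneg _) hs))
  obtain ⟨x, y, e⟩ : ∃ x y : ℝ, v = x • unitVec s + y • unitVec u := ⟨_, _, eq_combination hsin v⟩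
  have eM : act M v = l • (x • unitVec s + (m / l * y) • unitVec u) := by
    rw [e, act, map_add, map_smul, map_smul]
    change x • act M (unitVec s) + y • act M (unitVec u) = _
    rw [es, eu, smul_add, smul_smul, smul_smul, smul_smul, smul_smul]
    congr 2
    · ring
    · field_simp
  rw [eM, arcForm_smul]
  refine mul_nonneg (sq_nonneg _) ?_
  rw [e] at hv
  simp only [arcForm, detAngle_add, detAngle_smul] at hs hu hv ⊢
  set ε : ℝ := if θ₀ ≤ θ₁ then -1 else 1
  set p1 := detAngle θ₀ (unitVec s)
  set p2 := detAngle θ₀ (unitVec u)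
  set r1 := detAngle θ₁ (unitVec s)
  set r2 := detAngle θ₁ (unitVec u)
  set ρ := m / l
  -- For a quadratic form `Q` in the eigenbasis, `Q(x, ρ y)` is `ρ Q(x, y)` plus `(1 - ρ) x ^ 2
  -- Q(s)` minus `ρ (1 - ρ) y ^ 2 Q(u)`; the three terms follow.
  have h1 : 0 ≤ (1 - ρ) * (x ^ 2 * (ε * (p1 * r1))) :=
    mul_nonneg (by linarith) (mul_nonneg (sq_nonneg _) hs)
  have h2 : 0 ≤ ρ * (ε * ((x * p1 + y * p2) * (x * r1 + y * r2))) := mul_nonneg hpos.le hv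
  have h3 : 0 ≤ ρ * (1 - ρ) * (y ^ 2 * -(ε * (p2 * r2))) :=
    mul_nonneg (mul_nonneg hpos.le (by linarith)) (mul_nonneg (sq_nonneg _) (by linarith))
  linarith

/-! ### The norm function -/

theorem normFun_sq (M : Matrix (Fin 2) (Fin 2) ℝ) (θ : ℝ) :
    normFun M θ ^ 2 = (M 0 0 * Real.cos θ + M 0 1 * Real.sin θ) ^ 2
      + (M 1 0 * Real.cos θ + M 1 1 * Real.sin θ) ^ 2 := by
  rw [normFun, norm_sq_plane]
  simp [act_apply]

/-- If `H` equals `1` at two different angles then `H ^ 2 - 1` is a multiple of the product of two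
sines. -/
theorem exists_normFun_sq_eq {M : Matrix (Fin 2) (Fin 2) ℝ} {a b : ℝ} (hab : Real.sin (b - a) ≠ 0)
    (ha : normFun M a = 1) (hb : normFun M b = 1) :
    ∃ k : ℝ, ∀ θ, normFun M θ ^ 2 = k * (Real.sin (θ - a) * Real.sin (θ - b)) + 1 := by
  have ha2 := normFun_sq M a
  have hb2 := normFun_sq M b
  rw [ha] at ha2
  rw [hb] at hb2
  refine ⟨-2 * ((M 0 0 * Real.cos a + M 0 1 * Real.sin a) * (M 0 0 * Real.cos b + M 0 1 * Real.sin b)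
      + (M 1 0 * Real.cos a + M 1 1 * Real.sin a) * (M 1 0 * Real.cos b + M 1 1 * Real.sin b)
      - (Real.cos a * Real.cos b + Real.sin a * Real.sin b)) / Real.sin (b - a) ^ 2, fun θ => ?_⟩
  -- The unit vector is expanded in the directions `a` and `b`. As the form `H ^ 2 - 1` vanishes on
  -- both, only the mixed product survives.
  have e0 : Real.sin (b - a) * Real.cos θ
      = -Real.sin (θ - b) * Real.cos a + Real.sin (θ - a) * Real.cos b := by
    simp only [Real.sin_sub]
    ring
  have e1 : Real.sin (b - a) * Real.sin θ
      = -Real.sin (θ - b) * Real.sin a + Real.sin (θ - a) * Real.sin b := by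
    simp only [Real.sin_sub]
    ring
  rw [normFun_sq]
  set σ := Real.sin (b - a)
  set α := Real.sin (θ - a)
  set β := Real.sin (θ - b)
  have key : σ ^ 2 * ((M 0 0 * Real.cos θ + M 0 1 * Real.sin θ) ^ 2
      + (M 1 0 * Real.cos θ + M 1 1 * Real.sin θ) ^ 2 - (Real.cos θ ^ 2 + Real.sin θ ^ 2))
      = -2 * ((M 0 0 * Real.cos a + M 0 1 * Real.sin a) * (M 0 0 * Real.cos b + M 0 1 * Real.sin b)
      + (M 1 0 * Real.cos a + M 1 1 * Real.sin a) * (M 1 0 * Real.cos b + M 1 1 * Real.sin b)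
      - (Real.cos a * Real.cos b + Real.sin a * Real.sin b)) * (α * β) := by
    have f0 : σ * (M 0 0 * Real.cos θ + M 0 1 * Real.sin θ)
        = M 0 0 * (σ * Real.cos θ) + M 0 1 * (σ * Real.sin θ) := by ring
    have f1 : σ * (M 1 0 * Real.cos θ + M 1 1 * Real.sin θ)
        = M 1 0 * (σ * Real.cos θ) + M 1 1 * (σ * Real.sin θ) := by ring
    rw [mul_sub, mul_add, mul_add, ← mul_pow, ← mul_pow, f0, f1, ← mul_pow, ← mul_pow, e0, e1]
    linear_combination (-β ^ 2) * ha2 - α ^ 2 * hb2 - β ^ 2 * Real.cos_sq_add_sin_sq a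
      - α ^ 2 * Real.cos_sq_add_sin_sq b
  rw [Real.cos_sq_add_sin_sq] at key
  have hσ : σ ^ 2 ≠ 0 := pow_ne_zero 2 hab
  field_simp
  linear_combination key

/-- The form `H ^ 2 - 1` is a multiple `k` of the form that cuts out the arc from `dec` to `inc`.
The sign of the derivative at `dec` fixes the sign of `k`, so `H` exceeds `1` precisely off the arc.
-/
theorem one_lt_normFun {M : Matrix (Fin 2) (Fin 2) ℝ} {dec inc θ : ℝ} (h : IsDecInc M dec inc)
    (hθ : θ ∈ Set.Ico 0 Real.pi) (hout : θ ∉ circIcc dec inc) : 1 < normFun M θ := by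
  obtain ⟨hne, hset, hdec, -⟩ := h
  have hd : dec ∈ Set.Ico 0 Real.pi ∧ normFun M dec = 1 := by
    have : dec ∈ ({dec, inc} : Set ℝ) := by simp
    rwa [← hset] at this
  have hi : inc ∈ Set.Ico 0 Real.pi ∧ normFun M inc = 1 := by
    have : inc ∈ ({dec, inc} : Set ℝ) := by simp
    rwa [← hset] at this
  have hsin : Real.sin (inc - dec) ≠ 0 := by
    rcases lt_or_gt_of_ne hne with hlt | hlt
    · exact (sin_sub_pos hd.1 hi.1 hlt).ne'
    · exact (sin_sub_neg hd.1 hi.1 hlt).ne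
  obtain ⟨k, hk⟩ := exists_normFun_sq_eq hsin hd.2 hi.2
  have hfun : normFun M = fun t => Real.sqrt (k * (Real.sin (t - dec) * Real.sin (t - inc)) + 1) := by
    funext t
    rw [← hk t, Real.sqrt_sq (show 0 ≤ normFun M t from norm_nonneg _)]
  have hs1 : HasDerivAt (fun t => Real.sin (t - dec)) 1 dec := by
    have := ((hasDerivAt_id dec).sub_const dec).sin
    simpa using this
  have hs2 : HasDerivAt (fun t => Real.sin (t - inc)) (Real.cos (dec - inc)) dec := by
    have := ((hasDerivAt_id dec).sub_const inc).sin
    simpa using this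
  have hD := (((hs1.mul hs2).const_mul k).add_const 1).sqrt (by simp)
  have hderiv : deriv (normFun M) dec = k * Real.sin (dec - inc) / 2 := by
    rw [hfun]
    refine hD.deriv.trans ?_
    simp
  rw [hderiv] at hdec
  rw [mem_circIcc_iff hd.1 hi.1 hθ, not_le, arcForm, detAngle_unitVec, detAngle_unitVec] at hout
  have hpos : 0 < k * (Real.sin (θ - dec) * Real.sin (θ - inc)) := by
    rcases lt_or_gt_of_ne hne with hlt | hlt
    · rw [if_pos hlt.le] at hout
      have h1 := sin_sub_neg hi.1 hd.1 hlt
      have hk0 : 0 < k := by by_contra hc; push Not at hc; nlinarith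
      exact mul_pos hk0 (by linarith)
    · rw [if_neg (not_le.2 hlt)] at hout
      have h1 := sin_sub_pos hi.1 hd.1 hlt
      have hk0 : k < 0 := by by_contra hc; push Not at hc; nlinarith
      exact mul_pos_of_neg_of_neg hk0 (by linarith)
  have := hk θ
  have h0 : 0 ≤ normFun M θ := norm_nonneg _
  nlinarith
end

noncomputable section
namespace BCNF

/-! ### The invariant expanding cone -/

/-- The closed cone of vectors in all arcs that separate stable from unstable directions. -/
def closedCone (P : BCNF) (pmin pmax : ℕ) : Set Plane :=
  {v | ∀ θ₀ θ₁ : ℝ, P.Separates pmin pmax θ₀ θ₁ → 0 ≤ arcForm θ₀ θ₁ v}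

theorem isClosed_closedCone (P : BCNF) (pmin pmax : ℕ) : IsClosed (P.closedCone pmin pmax) := by
  have : P.closedCone pmin pmax = ⋂ (θ₀ : ℝ) (θ₁ : ℝ) (_ : P.Separates pmin pmax θ₀ θ₁),
      {v | 0 ≤ arcForm θ₀ θ₁ v} := by
    ext v; simp [closedCone]
  rw [this]
  exact isClosed_iInter fun _ => isClosed_iInter fun _ => isClosed_iInter fun _ =>
    isClosed_le continuous_const (continuous_arcForm _ _)

variable {P : BCNF} {pmin pmax : ℕ}

theorem smul_mem_closedCone {v : Plane} (hv : v ∈ P.closedCone pmin pmax) (r : ℝ) :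
    r • v ∈ P.closedCone pmin pmax := fun θ₀ θ₁ h => by
  rw [arcForm_smul]
  exact mul_nonneg (sq_nonneg _) (hv θ₀ θ₁ h)

theorem cone_subset_closedCone : cone (P.J pmin pmax) ⊆ P.closedCone pmin pmax := by
  rintro v ⟨α, θ, hθ, rfl⟩
  refine smul_mem_closedCone (fun θ₀ θ₁ h => ?_) α
  have hmem := hθ θ₀ θ₁ h
  exact (mem_circIcc_iff h.1 h.2.1 hmem.1).1 hmem

theorem exists_mem_J {v : Plane} (hv : v ∈ P.closedCone pmin pmax) (hv0 : v ≠ 0) :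
    ∃ θ ∈ P.J pmin pmax, θ ∈ Set.Ico 0 Real.pi ∧ ∃ r : ℝ, r ≠ 0 ∧ v = r • unitVec θ := by
  obtain ⟨θ, hθ, r, hr, rfl⟩ := exists_angle hv0
  refine ⟨θ, fun θ₀ θ₁ h => (mem_circIcc_iff h.1 h.2.1 hθ).2 ?_, hθ, r, hr, rfl⟩
  have := hv θ₀ θ₁ h
  rw [arcForm_smul] at this
  exact nonneg_of_mul_nonneg_right this (by positivity)

theorem det_AL (P : BCNF) : P.AL.det = P.deltaL := by simp [AL, Matrix.det_fin_two]

theorem det_AR (P : BCNF) : P.AR.det = P.deltaR := by simp [AR, Matrix.det_fin_two]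

theorem det_M_pos (P : BCNF) (p q : ℕ) : 0 < (P.M p q).det := by
  have := P.deltaL_pos
  have := P.deltaR_pos
  rw [M, Matrix.det_mul, Matrix.det_pow, Matrix.det_pow, det_AL, det_AR]
  positivity

theorem OutputsChaos.act_mem_closedCone (h : P.OutputsChaos pmin pmax) {x : ℕ × ℕ}
    (hx : x ∈ P.Gam pmin pmax) {v : Plane} (hv : v ∈ P.closedCone pmin pmax) :
    act (P.M x.1 x.2) v ∈ P.closedCone pmin pmax := by
  intro θ₀ θ₁ hsep
  obtain ⟨s, u, l, m, hs, hu, hl, hpos, hlt, es, eu⟩ :=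
    exists_stable_unstable (P.det_M_pos x.1 x.2) (h.step3 x hx)
  have h1 := (hsep.2.2 x hx s).1 hs
  have h2 := (hsep.2.2 x hx u).2 hu
  rw [mem_circIcc_iff hsep.1 hsep.2.1 hs.1] at h1
  rw [mem_circIcc_iff hsep.1 hsep.2.1 hu.1, not_le] at h2
  exact arcForm_act_nonneg hl hpos hlt es eu h1 h2 (hv θ₀ θ₁ hsep)

theorem OutputsChaos.norm_lt (h : P.OutputsChaos pmin pmax) {x : ℕ × ℕ}
    (hx : x ∈ P.Gam pmin pmax) {v : Plane} (hv : v ∈ P.closedCone pmin pmax) (hv1 : ‖v‖ = 1) :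
    1 < ‖act (P.M x.1 x.2) v‖ := by
  obtain ⟨θ, hJ, hθ, r, hr, rfl⟩ := exists_mem_J hv (by rintro rfl; simp at hv1)
  obtain ⟨dec, inc, hdi, hempty⟩ := h.step5 x hx
  have hout : θ ∉ circIcc dec inc := fun hc => by
    have : θ ∈ P.J pmin pmax ∩ circIcc dec inc := ⟨hJ, hc⟩
    rw [hempty] at this
    exact this
  have := one_lt_normFun hdi hθ hout
  rw [norm_smul, norm_unitVec, mul_one] at hv1
  rw [act_smul, norm_smul, hv1, one_mul]
  exact this

/-- The action of a matrix as a continuous linear map. -/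
def _root_.actCLM (M : Matrix (Fin 2) (Fin 2) ℝ) : Plane →L[ℝ] Plane :=
  LinearMap.toContinuousLinearMap (Matrix.toEuclideanLin M)

theorem _root_.actCLM_apply (M : Matrix (Fin 2) (Fin 2) ℝ) (v : Plane) : actCLM M v = act M v := rfl

theorem finite_Gam (P : BCNF) (pmin pmax : ℕ) : (P.Gam pmin pmax).Finite :=
  ((Set.finite_Icc pmin pmax).prod
    (Set.finite_Icc (P.qMin pmin pmax) (P.qMax pmin pmax))).subset
    fun _ hx => ⟨⟨hx.1, hx.2.1⟩, ⟨hx.2.2.1, hx.2.2.2⟩⟩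

/-- Each norm attains its minimum on the compact set of unit vectors in the closed cone, and that
minimum exceeds `1`; finiteness of `Γ` gives a common bound. -/
theorem OutputsChaos.exists_expansion (h : P.OutputsChaos pmin pmax) :
    ∃ c : ℝ, 1 < c ∧ ∀ x ∈ P.Gam pmin pmax, ∀ v ∈ P.closedCone pmin pmax,
      c * ‖v‖ ≤ ‖act (P.M x.1 x.2) v‖ := by
  have hK : IsCompact (Metric.sphere (0 : Plane) 1 ∩ P.closedCone pmin pmax) :=
    (isCompact_sphere 0 1).inter_right (P.isClosed_closedCone pmin pmax)
  have hone : ∀ x ∈ P.Gam pmin pmax, ∃ c : ℝ, 1 < c ∧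
      ∀ v ∈ Metric.sphere (0 : Plane) 1 ∩ P.closedCone pmin pmax,
        c ≤ ‖act (P.M x.1 x.2) v‖ := by
    intro x hx
    rcases (Metric.sphere (0 : Plane) 1 ∩ P.closedCone pmin pmax).eq_empty_or_nonempty with he | hne
    · exact ⟨2, one_lt_two, fun v hv => by rw [he] at hv; exact hv.elim⟩
    · obtain ⟨v₀, hv₀, hmin⟩ := hK.exists_isMinOn hne
        (f := fun v => ‖act (P.M x.1 x.2) v‖)
        ((actCLM (P.M x.1 x.2)).continuous.norm.continuousOn)
      exact ⟨_, h.norm_lt hx hv₀.2 (by simpa using hv₀.1), fun v hv => hmin hv⟩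
  have hall : ∀ S : Set (ℕ × ℕ), S.Finite → S ⊆ P.Gam pmin pmax → ∃ c : ℝ, 1 < c ∧ ∀ x ∈ S,
      ∀ v ∈ Metric.sphere (0 : Plane) 1 ∩ P.closedCone pmin pmax,
        c ≤ ‖act (P.M x.1 x.2) v‖ := by
    intro S hS
    induction S, hS using Set.Finite.induction_on with
    | empty => exact fun _ => ⟨2, one_lt_two, by simp⟩
    | @insert a S _ _ ih =>
      intro hsub
      obtain ⟨c, hc, hcS⟩ := ih ((Set.subset_insert _ _).trans hsub)
      obtain ⟨d, hd, hda⟩ := hone a (hsub (Set.mem_insert _ _))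
      refine ⟨min c d, lt_min hc hd, ?_⟩
      rintro x (rfl | hx) v hv
      · exact (min_le_right _ _).trans (hda v hv)
      · exact (min_le_left _ _).trans (hcS x hx v hv)
  obtain ⟨c, hc, hcG⟩ := hall _ (P.finite_Gam pmin pmax) subset_rfl
  refine ⟨c, hc, fun x hx v hv => ?_⟩
  rcases eq_or_ne v 0 with rfl | hv0
  · simp
  · have hn : ‖v‖ ≠ 0 := norm_ne_zero_iff.2 hv0
    have := hcG x hx (‖v‖⁻¹ • v) ⟨by simp [norm_smul, hn], smul_mem_closedCone hv _⟩
    rw [act_smul, norm_smul, norm_inv, norm_norm, inv_mul_eq_div, le_div_iff₀ (by positivity)] at this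
    exact this

/-! ### Derivatives along orbits -/

/-- The derivative of `f` at points off the switching manifold. -/
def stepMatrix (P : BCNF) (Z : Plane) : Matrix (Fin 2) (Fin 2) ℝ :=
  open Classical in if Z 0 ≤ 0 then P.AL else P.AR

/-- The derivative of `f^n` at points whose orbit avoids the switching manifold. -/
def derivMatrix (P : BCNF) (Z : Plane) : ℕ → Matrix (Fin 2) (Fin 2) ℝ
  | 0 => 1
  | n + 1 => P.stepMatrix (P.f^[n] Z) * derivMatrix P Z n

theorem hasFDerivAt_f {Z : Plane} (h : Z 0 ≠ 0) : HasFDerivAt P.f (actCLM (P.stepMatrix Z)) Z := by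
  have hc : Continuous fun W : Plane => W 0 := by fun_prop
  rcases lt_or_gt_of_ne h with hlt | hgt
  · rw [stepMatrix, if_pos hlt.le]
    refine ((actCLM P.AL).hasFDerivAt.add_const !₂[1, 0]).congr_of_eventuallyEq ?_
    filter_upwards [hc.continuousAt.eventually_lt continuousAt_const hlt] with W hW
    rw [f, if_pos hW.le]
    rfl
  · rw [stepMatrix, if_neg (not_le.2 hgt)]
    refine ((actCLM P.AR).hasFDerivAt.add_const !₂[1, 0]).congr_of_eventuallyEq ?_
    filter_upwards [continuousAt_const.eventually_lt hc.continuousAt hgt] with W hW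
    rw [f, if_neg (not_le.2 hW)]
    rfl

theorem actCLM_mul (M N : Matrix (Fin 2) (Fin 2) ℝ) :
    actCLM (M * N) = (actCLM M).comp (actCLM N) := by
  ext1 v
  exact act_mul M N v

theorem hasFDerivAt_iterate {Z : Plane} {n : ℕ} (h : ∀ i < n, P.f^[i] Z 0 ≠ 0) :
    HasFDerivAt (P.f^[n]) (actCLM (P.derivMatrix Z n)) Z := by
  induction n with
  | zero =>
    have : actCLM (P.derivMatrix Z 0) = ContinuousLinearMap.id ℝ Plane := by
      ext1 v
      apply plane_ext <;> simp [actCLM_apply, act_apply, derivMatrix]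
    rw [this]
    exact hasFDerivAt_id Z
  | succ n ih =>
    rw [derivMatrix, actCLM_mul, Function.iterate_succ']
    exact (hasFDerivAt_f (h n (by omega))).comp Z (ih fun i hi => h i (by omega))

theorem derivMatrix_add (Z : Plane) (m n : ℕ) :
    P.derivMatrix Z (m + n) = P.derivMatrix (P.f^[n] Z) m * P.derivMatrix Z n := by
  induction m with
  | zero => simp [derivMatrix]
  | succ m ih =>
    rw [show m + 1 + n = m + n + 1 by omega, derivMatrix, derivMatrix, ih,
      Function.iterate_add_apply, mul_assoc]

theorem derivMatrix_left {Z : Plane} {n : ℕ} (h : ∀ i < n, P.f^[i] Z 0 ≤ 0) :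
    P.derivMatrix Z n = P.AL ^ n := by
  induction n with
  | zero => rfl
  | succ n ih =>
    rw [derivMatrix, ih fun i hi => h i (by omega), stepMatrix, if_pos (h n (by omega)), pow_succ']

theorem derivMatrix_right {Z : Plane} {n : ℕ} (h : ∀ i < n, 0 < P.f^[i] Z 0) :
    P.derivMatrix Z n = P.AR ^ n := by
  induction n with
  | zero => rfl
  | succ n ih =>
    rw [derivMatrix, ih fun i hi => h i (by omega), stepMatrix,
      if_neg (not_le.2 (h n (by omega))), pow_succ']

/-- The constant comes from the norm of the inverse; adding `1` to that norm keeps it at most `1`,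
so its powers decrease. -/
theorem exists_act_lower_bound {M : Matrix (Fin 2) (Fin 2) ℝ} (h : M.det ≠ 0) :
    ∃ m : ℝ, 0 < m ∧ m ≤ 1 ∧ ∀ v : Plane, m * ‖v‖ ≤ ‖act M v‖ := by
  have hinv : M⁻¹ * M = 1 := Matrix.nonsing_inv_mul M (isUnit_iff_ne_zero.2 h)
  have hb : 0 < 1 + ‖actCLM M⁻¹‖ := by positivity
  refine ⟨(1 + ‖actCLM M⁻¹‖)⁻¹, by positivity,
    inv_le_one_of_one_le₀ (by linarith [norm_nonneg (actCLM M⁻¹)]), fun v => ?_⟩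
  rw [inv_mul_le_iff₀ hb]
  have e : v = actCLM M⁻¹ (act M v) := by
    rw [actCLM_apply, ← act_mul, hinv]
    apply plane_ext <;> simp [act_apply]
  have h1 := (actCLM M⁻¹).le_opNorm (act M v)
  rw [← e] at h1
  nlinarith [norm_nonneg (act M v)]

theorem exists_derivMatrix_lower_bound (P : BCNF) :
    ∃ m : ℝ, 0 < m ∧ m ≤ 1 ∧ ∀ (Z v : Plane) (n : ℕ),
      m ^ n * ‖v‖ ≤ ‖act (P.derivMatrix Z n) v‖ := by
  obtain ⟨a, ha0, ha1, ha⟩ := exists_act_lower_bound (M := P.AL)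
    (by rw [det_AL]; exact P.deltaL_pos.ne')
  obtain ⟨b, hb0, hb1, hb⟩ := exists_act_lower_bound (M := P.AR)
    (by rw [det_AR]; exact P.deltaR_pos.ne')
  have hm0 : 0 < min a b := lt_min ha0 hb0
  have hstep : ∀ Z v, min a b * ‖v‖ ≤ ‖act (P.stepMatrix Z) v‖ := by
    intro Z v
    rw [stepMatrix]
    split_ifs
    · exact (mul_le_mul_of_nonneg_right (min_le_left _ _) (norm_nonneg v)).trans (ha v)
    · exact (mul_le_mul_of_nonneg_right (min_le_right _ _) (norm_nonneg v)).trans (hb v)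
  refine ⟨min a b, hm0, (min_le_left _ _).trans ha1, fun Z v n => ?_⟩
  induction n with
  | zero =>
    have : act (P.derivMatrix Z 0) v = v := by
      apply plane_ext <;> simp [act_apply, derivMatrix]
    rw [this]; simp
  | succ n ih =>
    rw [derivMatrix, act_mul, pow_succ', mul_assoc]
    exact (mul_le_mul_of_nonneg_left ih hm0.le).trans (hstep _ _)

/-! ### Points of `Ω` whose orbit avoids the switching manifold -/

theorem f_iterate_ne_zero {Z : Plane} (hZ : Z ∈ P.Omega pmin pmax \ P.XiInf pmin pmax) {i : ℕ}
    (hi : i < P.returnTime Z) : P.f^[i] Z 0 ≠ 0 :=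
  fun h0 => hZ.2 ⟨hZ.1, 0, hZ.1, i, hi, h0⟩

theorem OutputsChaos.F_mem (h : P.OutputsChaos pmin pmax) {Z : Plane}
    (hZ : Z ∈ P.Omega pmin pmax \ P.XiInf pmin pmax) :
    P.F Z ∈ P.Omega pmin pmax \ P.XiInf pmin pmax := by
  obtain ⟨p, q, hE⟩ := h.exists_excursion hZ.1
  exact ⟨hE.F_mem, fun ⟨_, i, hi⟩ => hZ.2 ⟨hZ.1, i + 1, by rwa [Function.iterate_succ_apply]⟩⟩

/-- The orbit is cut at the returns: before the first one it avoids the axis because the point is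
not in `Xi`, and afterwards the statement for fewer steps applies to `F Z`. -/
theorem OutputsChaos.f_iterate_ne_zero (h : P.OutputsChaos pmin pmax) (i : ℕ) :
    ∀ Z ∈ P.Omega pmin pmax \ P.XiInf pmin pmax, P.f^[i] Z 0 ≠ 0 := by
  induction i using Nat.strong_induction_on with
  | _ i ih =>
    intro Z hZ
    by_cases hi : i < P.returnTime Z
    · exact BCNF.f_iterate_ne_zero hZ hi
    · push Not at hi
      obtain ⟨p, q, hE⟩ := h.exists_excursion hZ.1
      have hr := hE.returnTime_eq
      have hp := hE.pos_left
      have := ih (i - P.returnTime Z) (by omega) (P.F Z) (h.F_mem hZ)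
      rwa [F, ← Function.iterate_add_apply, Nat.sub_add_cancel hi] at this

theorem OutputsChaos.derivMatrix_return (h : P.OutputsChaos pmin pmax) {Z : Plane}
    (hZ : Z ∈ P.Omega pmin pmax \ P.XiInf pmin pmax) :
    ∃ x ∈ P.Gam pmin pmax, 1 ≤ P.returnTime Z ∧ P.returnTime Z ≤ pmax + P.qMax pmin pmax ∧
      P.derivMatrix Z (P.returnTime Z) = P.M x.1 x.2 := by
  obtain ⟨p, q, hE⟩ := h.exists_excursion hZ.1
  have hr := hE.returnTime_eq
  have hp := hE.pos_left
  have hG := hE.mem_Gam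
  refine ⟨(p, q), hG, by omega, ?_, ?_⟩
  · have h1 : p ≤ pmax := hG.2.1
    have h2 : q ≤ P.qMax pmin pmax := hG.2.2.2
    omega
  · rw [hr, add_comm, derivMatrix_add, derivMatrix_left hE.left, derivMatrix_right, M]
    intro i hi
    rw [← Function.iterate_add_apply]
    exact lt_of_le_of_ne (hE.right _ (by omega) (by omega))
      (BCNF.f_iterate_ne_zero hZ (by omega)).symm

/-- Vectors in the cone grow exponentially. -/
theorem OutputsChaos.exists_growth (h : P.OutputsChaos pmin pmax) :
    ∃ K ρ : ℝ, 0 < K ∧ 1 < ρ ∧ ∀ (n : ℕ), ∀ Z ∈ P.Omega pmin pmax \ P.XiInf pmin pmax,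
      ∀ v ∈ P.closedCone pmin pmax, K * ρ ^ n * ‖v‖ ≤ ‖act (P.derivMatrix Z n) v‖ := by
  obtain ⟨c, hc, hexp⟩ := h.exists_expansion
  obtain ⟨m, hm0, hm1, hlow⟩ := P.exists_derivMatrix_lower_bound
  set B := pmax + P.qMax pmin pmax with hB
  have hB0 : B ≠ 0 := by
    have := h.pmin_lt
    omega
  -- `B` bounds every return time, so a factor `c` per return is worth at least `ρ` per step.
  set ρ := c ^ (1 / (B : ℝ)) with hρ
  have hρ1 : 1 < ρ := Real.one_lt_rpow hc (by positivity)
  have hρB : ρ ^ B = c := by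
    rw [hρ, one_div]
    exact Real.rpow_inv_natCast_pow (by linarith) hB0
  have hρ0 : 0 < ρ := by linarith
  refine ⟨m ^ B / ρ ^ B, ρ, by positivity, hρ1, fun n => ?_⟩
  induction n using Nat.strong_induction_on with
  | _ n ih =>
    intro Z hZ v hv
    obtain ⟨x, hx, hr1, hrB, hM⟩ := h.derivMatrix_return hZ
    by_cases hn : n < P.returnTime Z
    -- An incomplete last excursion has fewer than `B` steps, each contracting by at most `m`; the
    -- constant `m ^ B / ρ ^ B` pays for it.
    · refine le_trans ?_ (hlow Z v n)
      refine mul_le_mul_of_nonneg_right ?_ (norm_nonneg v)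
      have h1 : m ^ B ≤ m ^ n := pow_le_pow_of_le_one hm0.le hm1 (by omega)
      have h2 : ρ ^ n ≤ ρ ^ B := pow_le_pow_right₀ hρ1.le (by omega)
      rw [div_mul_eq_mul_div, div_le_iff₀ (by positivity)]
      exact mul_le_mul h1 h2 (by positivity) (by positivity)
    · push Not at hn
      obtain ⟨k, rfl⟩ := Nat.exists_eq_add_of_le' hn
      have h1 := ih k (by omega) (P.F Z) (h.F_mem hZ) _ (h.act_mem_closedCone hx hv)
      rw [derivMatrix_add, act_mul, hM]
      refine le_trans ?_ h1
      have h2 := hexp x hx v hv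
      have h3 : ρ ^ P.returnTime Z ≤ c := by
        rw [← hρB]; exact pow_le_pow_right₀ hρ1.le hrB
      calc m ^ B / ρ ^ B * ρ ^ (k + P.returnTime Z) * ‖v‖
          = m ^ B / ρ ^ B * ρ ^ k * (ρ ^ P.returnTime Z * ‖v‖) := by rw [pow_add]; ring
        _ ≤ m ^ B / ρ ^ B * ρ ^ k * ‖act (P.M x.1 x.2) v‖ := by
          refine mul_le_mul_of_nonneg_left ?_ (by positivity)
          exact (mul_le_mul_of_nonneg_right h3 (norm_nonneg v)).trans h2

end BCNF

/-! ### From exponential growth to a positive lower exponent. -/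

theorem liminf_log_pos {a : ℕ → ℝ} {C ρ : ℝ} (hC : 0 < C) (hρ : 1 < ρ)
    (h : ∀ n, C * ρ ^ n ≤ a n) :
    (0 : EReal) < Filter.liminf (fun n : ℕ => ((1 / (n : ℝ) * Real.log (a n) : ℝ) : EReal))
      Filter.atTop := by
  have hlog : 0 < Real.log ρ := Real.log_pos hρ
  have hlim : Tendsto (fun n : ℕ => Real.log C / (n : ℝ) + Real.log ρ) atTop
      (𝓝 (0 + Real.log ρ)) := (tendsto_const_div_atTop_nhds_zero_nat _).add_const _
  have hev : ∀ᶠ n : ℕ in atTop, Real.log ρ / 2 < Real.log C / (n : ℝ) + Real.log ρ :=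
    hlim.eventually_const_lt (by linarith)
  have hle : ((Real.log ρ / 2 : ℝ) : EReal) ≤ Filter.liminf
      (fun n : ℕ => ((1 / (n : ℝ) * Real.log (a n) : ℝ) : EReal)) Filter.atTop := by
    refine le_liminf_of_le (by isBoundedDefault) ?_
    filter_upwards [hev, eventually_gt_atTop 0] with n hn hn0
    rw [EReal.coe_le_coe_iff]
    have hn' : (0 : ℝ) < n := by exact_mod_cast hn0
    have h1 : Real.log C + n * Real.log ρ ≤ Real.log (a n) := by
      rw [← Real.log_pow, ← Real.log_mul hC.ne' (by positivity)]
      exact Real.log_le_log (by positivity) (h n)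
    refine hn.le.trans ?_
    rw [one_div, inv_mul_eq_div, le_div_iff₀ hn', add_mul, div_mul_cancel₀ _ hn'.ne']
    linarith
  exact lt_of_lt_of_le (by exact_mod_cast half_pos hlog) hle

end

theorem theorem10p2 (P : BCNF) (pmin pmax : ℕ) (hchaos : P.OutputsChaos pmin pmax) :
    ∀ Z ∈ P.Omega pmin pmax \ P.XiInf pmin pmax,
      (∀ n : ℕ, DifferentiableAt ℝ (P.f^[n]) Z) ∧
      ∀ v ∈ cone (P.J pmin pmax), v ≠ 0 →
        (0 : EReal) < Filter.liminf
          (fun n : ℕ => ((1 / (n : ℝ) * Real.log ‖fderiv ℝ (P.f^[n]) Z v‖ : ℝ) : EReal))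
          Filter.atTop := by
  intro Z hZ
  have hD : ∀ n, HasFDerivAt (P.f^[n]) (actCLM (P.derivMatrix Z n)) Z := fun n =>
    BCNF.hasFDerivAt_iterate fun i _ => hchaos.f_iterate_ne_zero i Z hZ
  refine ⟨fun n => (hD n).differentiableAt, fun v hv hv0 => ?_⟩
  obtain ⟨K, ρ, hK, hρ, hgrow⟩ := hchaos.exists_growth
  refine liminf_log_pos (C := K * ‖v‖) (mul_pos hK (norm_pos_iff.2 hv0)) hρ fun n => ?_
  rw [(hD n).fderiv, actCLM_apply]
  have := hgrow n Z hZ v (BCNF.cone_subset_closedCone hv)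
  linarith
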